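/- Theorem 9 (Tensor product structure of stabilizer code isometries). Let $D$ be prime, $\omega=e^{2\pi i/D}$, $\lambda=e^{2\pi i/(2D)}$, and let $\mathcal H=\mathbb C^D$ with basis $\{|j\rangle\}_{j\in\mathbb Z_D}$, $Z=\sum_j\omega^j|j\rangle\langle j|$, $X=\sum_j|j\rangle\langle j+1|$. A Pauli product on $n$ qudits is an operator $\lambda^\gamma\bigotimes_q X^{x_q}Z^{z_q}$; a stabilizer group is an abelian group of linearly independent Pauli products, and an $[[n,k]]_D$ stabilizer code is the space, of dimension $D^k$, of all kets of $\mathcal H^{\otimes n}$ fixed by every element of a stabilizer group. Let $V:\mathcal H_A=\mathcal H^{\otimes k}\to\mathcal H^{\otimes n}$ be an isometry whose image is an $[[n,k]]_D$ stabilizer code, and let the $n$ output qudits be split into two disjoint parts $B$ and $C$, so that $V:\mathcal H_A\to\mathcal H_B\otimes\mathcal H_C$. Then there are non-negative integers $m_{ABC},m_{AB},m_{AC},m_{BC},m_B,m_C$ with $k=m_{ABC}+m_{AB}+m_{AC}$, $|B|=m_{ABC}+m_{AB}+m_{BC}+m_B$, $|C|=m_{ABC}+m_{AC}+m_{BC}+m_C$,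 and unitaries $U_A,U_B,U_C$ on $\mathcal H_A,\mathcal H_B,\mathcal H_C$ such that, after a suitable labelling of the qudits within each of $A$, $B$, $C$, $$(U_B\otimes U_C)\,V\,U_A=V_{\mathrm{GHZ}}^{\otimes m_{ABC}}\otimes V_{\mathrm{EPR}}^{\otimes m_{AB}}\otimes V_{\mathrm{EPR}}^{\otimes m_{AC}}\otimes|\mathrm{EPR}\rangle^{\otimes m_{BC}}\otimes|+\rangle^{\otimes m_B}\otimes|+\rangle^{\otimes m_C},$$ where $V_{\mathrm{GHZ}}=\sum_i|i\rangle_B|i\rangle_C\langle i|_A$, $V_{\mathrm{EPR}}=\sum_i|i\rangle\langle i|_A$ (from $A$ to $B$, respectively to $C$), $|\mathrm{EPR}\rangle=D^{-1/2}\sum_i|i\rangle_B|i\rangle_C$ and $|+\rangle=D^{-1/2}\sum_i|i\rangle$. As a consequence, with the same unitaries and labellings, the stabilizer code channels $\mathcal E_B(\rho)=\mathrm{Tr}_C(V\rho V^\dagger)$ and $\mathcal E_C(\rho)=\mathrm{Tr}_B(V\rho V^\dagger)$ are products of simple channels: $\rho\mapsto U_B\,\mathcal E_B(U_A\rho U_A^\dagger)\,U_B^\dagger$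 is the tensor product of $m_{ABC}$ perfectly decohering channels $\sigma\mapsto\sum_i|i\rangle\langle i|\sigma|i\rangle\langle i|$, $m_{AB}$ perfect (identity) channels, the completely depolarizing channel $\sigma\mapsto\mathrm{Tr}(\sigma)\,I/D^{m_{BC}}$ from $m_{AC}$ qudits to $m_{BC}$ qudits, and the fixed output state $(|+\rangle\langle+|)^{\otimes m_B}$; and $\rho\mapsto U_C\,\mathcal E_C(U_A\rho U_A^\dagger)\,U_C^\dagger$ is described in the same way with $B$ and $C$ exchanged. -/

import Mathlib

open scoped Matrix Kronecker

noncomputable section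

namespace StabCode

/-! Qudits of dimension `D` labelled by a finite type `Q` have the computational basis
`Q → ZMod D`; kets are functions on the basis and operators are complex matrices
indexed by it. -/

/-- The computational basis labels of a family of `D`-level qudits labelled by `Q`. -/
abbrev Cfg (D : ℕ) (Q : Type) : Type := Q → ZMod D

/-- Operators on (the Hilbert space with computational basis) `α`. -/
abbrev Op (α : Type) : Type := Matrix α α ℂ

/-- `ω = exp (2 π i / D)`. -/
def omega (D : ℕ) : ℂ := Complex.exp (2 * Real.pi * Complex.I / D)

/-- `λ = exp (2 π i / (2 D))`, a square root of `ω`. -/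
def lam (D : ℕ) : ℂ := Complex.exp (2 * Real.pi * Complex.I / (2 * D))

/-- The single-qudit operator `Z = ∑ j, ω ^ j |j⟩⟨j|`. -/
def pauliZ (D : ℕ) : Op (ZMod D) := Matrix.diagonal fun j => omega D ^ j.val

/-- The single-qudit operator `X = ∑ j, |j⟩⟨j+1|`. -/
def pauliX (D : ℕ) : Op (ZMod D) := Matrix.of fun i j => if j = i + 1 then 1 else 0

/-- The Pauli product `λ ^ γ · ⨂ q, X ^ (x q) Z ^ (z q)` on the qudits `Q`. -/
def pauliProduct (D : ℕ) [NeZero D] {Q : Type} [Fintype Q]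
    (γ : ZMod (2 * D)) (x z : Q → ZMod D) : Op (Cfg D Q) :=
  Matrix.of fun i j =>
    lam D ^ γ.val * ∏ q, (pauliX D ^ (x q).val * pauliZ D ^ (z q).val) (i q) (j q)

/-- A stabilizer group on the qudits `Q`: an abelian group, under operator multiplication, of
linearly independent Pauli products. -/
structure IsStabilizerGroup {D : ℕ} [NeZero D] {Q : Type} [Fintype Q] [DecidableEq Q]
    (S : Subgroup (Op (Cfg D Q))ˣ) : Prop where
  isPauli : ∀ s ∈ S, ∃ (γ : ZMod (2 * D)) (x z : Q → ZMod D),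
    (s : Op (Cfg D Q)) = pauliProduct D γ x z
  comm : ∀ s ∈ S, ∀ t ∈ S, s * t = t * s
  linearIndependent : LinearIndependent ℂ (fun s : S => ((s : (Op (Cfg D Q))ˣ) : Op (Cfg D Q)))

/-- The space of kets fixed by every element of `S`. -/
def codeSpace {D : ℕ} [NeZero D] {Q : Type} [Fintype Q] [DecidableEq Q]
    (S : Subgroup (Op (Cfg D Q))ˣ) : Submodule ℂ (Cfg D Q → ℂ) where
  carrier := {ψ | ∀ s ∈ S, (s : Op (Cfg D Q)) *ᵥ ψ = ψ}
  add_mem' := by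
    intro a b ha hb s hs
    rw [Matrix.mulVec_add, ha s hs, hb s hs]
  zero_mem' := by
    intro s _
    exact Matrix.mulVec_zero _
  smul_mem' := by
    intro c a ha s hs
    rw [Matrix.mulVec_smul, ha s hs]

/-- `C` is an `[[n, k]]_D` stabilizer code. -/
def IsStabilizerCode (D : ℕ) [NeZero D] (n k : ℕ) (C : Submodule ℂ (Cfg D (Fin n) → ℂ)) : Prop :=
  ∃ S : Subgroup (Op (Cfg D (Fin n)))ˣ,
    IsStabilizerGroup S ∧ codeSpace S = C ∧ Module.finrank ℂ C = D ^ k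

/-- `V` is an encoding isometry of an `[[n, k]]_D` stabilizer code: an isometry from `k` qudits
to `n` qudits whose image is such a code. -/
def IsStabilizerCodeIsometry {D : ℕ} [NeZero D] {n k : ℕ}
    (V : Matrix (Cfg D (Fin n)) (Cfg D (Fin k)) ℂ) : Prop :=
  Vᴴ * V = 1 ∧ IsStabilizerCode D n k (LinearMap.range V.mulVecLin)

/-! The bipartition of the output into the qudits in `B` and the remaining ones, `C`. -/

/-- Labels of the output qudits in part `B`. -/
abbrev PartB {n : ℕ} (B : Finset (Fin n)) : Type := {q : Fin n // q ∈ B}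

/-- Labels of the output qudits in part `C`, the complement of `B`. -/
abbrev PartC {n : ℕ} (B : Finset (Fin n)) : Type := {q : Fin n // q ∉ B}

/-- `V` regarded as a map into `H_B ⊗ H_C`. -/
def splitOutput {D n k : ℕ} (B : Finset (Fin n)) (V : Matrix (Cfg D (Fin n)) (Cfg D (Fin k)) ℂ) :
    Matrix (Cfg D (PartB B) × Cfg D (PartC B)) (Cfg D (Fin k)) ℂ :=
  V.submatrix (Equiv.piEquivPiSubtypeProd (fun q => q ∈ B) (fun _ => ZMod D)).symm id

/-- Partial trace over the second factor. -/
def traceSnd {β γ : Type} [Fintype γ] (M : Op (β × γ)) : Op β :=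
  Matrix.of fun b b' => ∑ c, M (b, c) (b', c)

/-- Partial trace over the first factor. -/
def traceFst {β γ : Type} [Fintype β] (M : Op (β × γ)) : Op γ :=
  Matrix.of fun c c' => ∑ b, M (b, c) (b, c')

/-- The direct stabilizer code channel `ρ ↦ Tr_C (V ρ V†)`. -/
def channelB {D : ℕ} [NeZero D] {n k : ℕ} (B : Finset (Fin n))
    (V : Matrix (Cfg D (Fin n)) (Cfg D (Fin k)) ℂ) (ρ : Op (Cfg D (Fin k))) :
    Op (Cfg D (PartB B)) :=
  traceSnd (splitOutput B V * ρ * (splitOutput B V)ᴴ)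

/-- The complementary stabilizer code channel `ρ ↦ Tr_B (V ρ V†)`. -/
def channelC {D : ℕ} [NeZero D] {n k : ℕ} (B : Finset (Fin n))
    (V : Matrix (Cfg D (Fin n)) (Cfg D (Fin k)) ℂ) (ρ : Op (Cfg D (Fin k))) :
    Op (Cfg D (PartC B)) :=
  traceFst (splitOutput B V * ρ * (splitOutput B V)ᴴ)

/-! The elementary isometries, kets and channels. -/

/-- `V_GHZ = ∑ i, |i⟩_B |i⟩_C ⟨i|_A`. -/
def vGHZ (D : ℕ) : Matrix (ZMod D × ZMod D) (ZMod D) ℂ :=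
  Matrix.of fun x a => if x.1 = a ∧ x.2 = a then 1 else 0

/-- `V_EPR = ∑ i, |i⟩⟨i|_A`, the perfect transfer of one qudit. -/
def vEPR (D : ℕ) : Matrix (ZMod D) (ZMod D) ℂ :=
  Matrix.of fun x a => if x = a then 1 else 0

/-- `|EPR⟩ = D ^ (-1/2) ∑ i, |i⟩|i⟩`. -/
def ketEPR (D : ℕ) (b c : ZMod D) : ℂ := if b = c then 1 / (Real.sqrt D : ℂ) else 0

/-- `|+⟩ = D ^ (-1/2) ∑ i, |i⟩`. -/
def ketPlus (D : ℕ) (_ : ZMod D) : ℂ := 1 / (Real.sqrt D : ℂ)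

/-- The matrix element `⟨b| T(|a⟩⟨a'|) |b'⟩` of a superoperator `T`. The matrix elements of a
tensor product of superoperators are the products of those of its factors. -/
def elem {α β : Type} [DecidableEq α] (T : Op α →ₗ[ℂ] Op β) (a a' : α) (b b' : β) : ℂ :=
  T (Matrix.single a a' 1) b b'

/-- The perfect channel on one qudit. -/
def perfect (D : ℕ) : Op (ZMod D) →ₗ[ℂ] Op (ZMod D) := LinearMap.id

/-- The perfectly decohering channel `ρ ↦ ∑ j, |j⟩⟨j| ρ |j⟩⟨j|` on one qudit. -/
def decohering (D : ℕ) [NeZero D] : Op (ZMod D) →ₗ[ℂ] Op (ZMod D) where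
  toFun ρ := ∑ j, Matrix.single j j 1 * ρ * Matrix.single j j 1
  map_add' := by
    intro x y
    simp only [mul_add, add_mul, Finset.sum_add_distrib]
  map_smul' := by
    intro c x
    simp only [Matrix.mul_smul, Matrix.smul_mul, Finset.smul_sum, RingHom.id_apply]

/-- The completely depolarizing channel `ρ ↦ Tr(ρ) · I / dim`. -/
def depolarizing (α β : Type) [Fintype α] [Fintype β] [DecidableEq β] : Op α →ₗ[ℂ] Op β where
  toFun ρ := (ρ.trace / (Fintype.card β : ℂ)) • (1 : Op β)
  map_add' := by
    intro x y
    rw [Matrix.trace_add, add_div, add_smul]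
  map_smul' := by
    intro c x
    rw [Matrix.trace_smul, smul_eq_mul, mul_div_assoc, RingHom.id_apply, mul_smul]

/-- The numbers of elementary tensor factors of each type. -/
structure Mult where
  (mABC mAB mAC mBC mB mC : ℕ)

namespace Mult

/-- Input qudits: one for each `A → BC`, each `A → B` and each `A → C` factor. -/
abbrev QA (m : Mult) : Type := Fin m.mABC ⊕ Fin m.mAB ⊕ Fin m.mAC

/-- Qudits of part `B`: one for each `A → BC`, `A → B`, `B`-`C` and `B` factor. -/
abbrev QB (m : Mult) : Type := Fin m.mABC ⊕ Fin m.mAB ⊕ Fin m.mBC ⊕ Fin m.mB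

/-- Qudits of part `C`: one for each `A → BC`, `A → C`, `B`-`C` and `C` factor. -/
abbrev QC (m : Mult) : Type := Fin m.mABC ⊕ Fin m.mAC ⊕ Fin m.mBC ⊕ Fin m.mC

variable (D : ℕ) (m : Mult)

/-- The restrictions of a basis label to the qudits of each type of factor. -/
abbrev aABC {m : Mult} {D : ℕ} (a : Cfg D m.QA) : Cfg D (Fin m.mABC) := fun i => a (.inl i)
abbrev aAB {m : Mult} {D : ℕ} (a : Cfg D m.QA) : Cfg D (Fin m.mAB) := fun i => a (.inr (.inl i))
abbrev aAC {m : Mult} {D : ℕ} (a : Cfg D m.QA) : Cfg D (Fin m.mAC) := fun i => a (.inr (.inr i))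
abbrev bABC {m : Mult} {D : ℕ} (b : Cfg D m.QB) : Cfg D (Fin m.mABC) := fun i => b (.inl i)
abbrev bAB {m : Mult} {D : ℕ} (b : Cfg D m.QB) : Cfg D (Fin m.mAB) := fun i => b (.inr (.inl i))
abbrev bBC {m : Mult} {D : ℕ} (b : Cfg D m.QB) : Cfg D (Fin m.mBC) :=
  fun i => b (.inr (.inr (.inl i)))
abbrev bB {m : Mult} {D : ℕ} (b : Cfg D m.QB) : Cfg D (Fin m.mB) :=
  fun i => b (.inr (.inr (.inr i)))
abbrev cABC {m : Mult} {D : ℕ} (c : Cfg D m.QC) : Cfg D (Fin m.mABC) := fun i => c (.inl i)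
abbrev cAC {m : Mult} {D : ℕ} (c : Cfg D m.QC) : Cfg D (Fin m.mAC) := fun i => c (.inr (.inl i))
abbrev cBC {m : Mult} {D : ℕ} (c : Cfg D m.QC) : Cfg D (Fin m.mBC) :=
  fun i => c (.inr (.inr (.inl i)))
abbrev cC {m : Mult} {D : ℕ} (c : Cfg D m.QC) : Cfg D (Fin m.mC) :=
  fun i => c (.inr (.inr (.inr i)))

/-- The tensor product
`V_GHZ^{⊗ mABC} ⊗ V_EPR^{⊗ mAB} ⊗ V_EPR^{⊗ mAC} ⊗ |EPR⟩^{⊗ mBC} ⊗ |+⟩^{⊗ mB} ⊗ |+⟩^{⊗ mC}`: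
its matrix elements are the products of those of its factors. -/
def isometry : Matrix (Cfg D m.QB × Cfg D m.QC) (Cfg D m.QA) ℂ :=
  Matrix.of fun x a =>
    (∏ i, vGHZ D (bABC x.1 i, cABC x.2 i) (aABC a i)) *
    (∏ i, vEPR D (bAB x.1 i) (aAB a i)) *
    (∏ i, vEPR D (cAC x.2 i) (aAC a i)) *
    (∏ i, ketEPR D (bBC x.1 i) (cBC x.2 i)) *
    (∏ i, ketPlus D (bB x.1 i)) *
    (∏ i, ketPlus D (cC x.2 i))

/-- The tensor product of `mABC` perfectly decohering channels, `mAB` perfect channels, the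
completely depolarizing channel from `mAC` qudits to `mBC` qudits, and `mB` fixed output states
`|+⟩⟨+|`. -/
def prodChannelB [NeZero D] (ρ : Op (Cfg D m.QA)) : Op (Cfg D m.QB) :=
  Matrix.of fun b b' => ∑ a, ∑ a', ρ a a' *
    ((∏ i, elem (decohering D) (aABC a i) (aABC a' i) (bABC b i) (bABC b' i)) *
     (∏ i, elem (perfect D) (aAB a i) (aAB a' i) (bAB b i) (bAB b' i)) *
     elem (depolarizing (Cfg D (Fin m.mAC)) (Cfg D (Fin m.mBC)))
        (aAC a) (aAC a') (bBC b) (bBC b') *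
     (∏ i, ketPlus D (bB b i) * star (ketPlus D (bB b' i))))

/-- The tensor product of `mABC` perfectly decohering channels, `mAC` perfect channels, the
completely depolarizing channel from `mAB` qudits to `mBC` qudits, and `mC` fixed output states
`|+⟩⟨+|`. -/
def prodChannelC [NeZero D] (ρ : Op (Cfg D m.QA)) : Op (Cfg D m.QC) :=
  Matrix.of fun c c' => ∑ a, ∑ a', ρ a a' *
    ((∏ i, elem (decohering D) (aABC a i) (aABC a' i) (cABC c i) (cABC c' i)) *
     (∏ i, elem (perfect D) (aAC a i) (aAC a' i) (cAC c i) (cAC c' i)) *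
     elem (depolarizing (Cfg D (Fin m.mAB)) (Cfg D (Fin m.mBC)))
        (aAB a) (aAB a') (cBC c) (cBC c') *
     (∏ i, ketPlus D (cC c i) * star (ketPlus D (cC c' i))))

end Mult

end StabCode

end

/-! A stabilizer code is determined by the scalar multiples of Weyl operators that fix it, so its
bipartite structure can be read off from symplectic linear algebra over `ZMod D`. Up to a scalar a
Pauli product is `weyl u` with `u` in phase space, and two Weyl operators commute up to `chi D (symp
D Q u v)`. Cutting the output into `B` and `C` makes phase space an orthogonal sum, and the
stabilizer becomes an isotropic subspace `L` of it: on `L` the two local forms are opposite to each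
other. The heart of the matter is `exists_isotropic_normal_form`. Restrict the `B`-form to `L` and
split off a maximal family of hyperbolic pairs; the rest is the radical, which contains the elements
supported on one side only; choose a complement of those in the radical. Hyperbolic pairs become the
generators of EPR pairs, one-sided elements those of `|+⟩` states, and the complement gives the `Z ⊗
Z†` constraints of GHZ factors. The symplectic directions left over on `B` and on `C` are not
constrained at all, and carry the qudits transferred perfectly from `A`. On each side the local
components of the generators extend to a symplectic basis (`exists_symplectic_basis`), and the
finite Stone–von Neumann theorem (`exists_weyl_frame`) yields a unitary turning them into clock and
raising operators. Hence the code is mapped onto the kets satisfying `IsStandardKet`, which form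
exactly the range of `Mult.isometry`. Two isometries with equal range differ by a unitary of the
input (`exists_unitary_of_range_eq`), which is `U_A`. The channels follow since partial traces are
compatible with local unitaries and the elementary isometry can be traced out explicitly
(`sum_isometry_mul_star_right`). Phases are never tracked, and nothing is divided by 2, so `D = 2`
needs no separate treatment. -/

noncomputable section

namespace StabCode

/-! ### Weyl operators -/

section Weyl

variable {D : ℕ} [Fact D.Prime] {Q : Type} [Fintype Q]

/-- The discrete phase space: shift and clock exponents of a Weyl operator. -/
abbrev Phase (D : ℕ) (Q : Type) : Type := (Q → ZMod D) × (Q → ZMod D)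

/-- The standard additive character `j ↦ exp (2 π i j / D)`. -/
abbrev chi (D : ℕ) [Fact D.Prime] : AddChar (ZMod D) ℂ := ZMod.stdAddChar

theorem star_chi (a : ZMod D) : star (chi D a) = chi D (-a) := by
  rw [AddChar.map_neg_eq_inv]
  exact ((Complex.inv_eq_conj (Circle.norm_coe _))).symm

theorem chi_injective : Function.Injective (chi D) := ZMod.injective_stdAddChar

theorem chi_eq_one_iff {a : ZMod D} : chi D a = 1 ↔ a = 0 := by
  rw [← AddChar.map_zero_eq_one (chi D), chi_injective.eq_iff]

theorem map_sum_chi {ι : Type} [Fintype ι] (f : ι → ZMod D) :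
    chi D (∑ i, f i) = ∏ i, chi D (f i) :=
  (map_prod (chi D).toMonoidHom (fun i => Multiplicative.ofAdd (f i)) Finset.univ)

/-- The Weyl operator `X ^ x Z ^ z` attached to `u = (x, z)`. -/
def weyl (u : Phase D Q) : Op (Cfg D Q) :=
  Matrix.of fun i j => if j = i + u.1 then chi D (u.2 ⬝ᵥ j) else 0

theorem weyl_apply (u : Phase D Q) (i j : Cfg D Q) :
    weyl u i j = if j = i + u.1 then chi D (u.2 ⬝ᵥ j) else 0 := rfl

/-- The symplectic form governing the commutation relations of Weyl operators. -/
def symp (D : ℕ) [Fact D.Prime] (Q : Type) [Fintype Q] :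
    LinearMap.BilinForm (ZMod D) (Phase D Q) :=
  LinearMap.mk₂ (ZMod D) (fun u v => v.2 ⬝ᵥ u.1 - u.2 ⬝ᵥ v.1)
    (by intros; simp [dotProduct_add, add_dotProduct]; ring)
    (by intros; simp [mul_sub])
    (by intros; simp [dotProduct_add, add_dotProduct]; ring)
    (by intros; simp [mul_sub])

theorem symp_apply (u v : Phase D Q) : symp D Q u v = v.2 ⬝ᵥ u.1 - u.2 ⬝ᵥ v.1 := rfl

theorem symp_isAlt : (symp D Q).IsAlt := fun u => by rw [symp_apply, sub_self]

theorem symp_nondegenerate (u : Phase D Q) (h : ∀ v, symp D Q u v = 0) : u = 0 := by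
  refine Prod.ext (dotProduct_eq_zero _ fun w => ?_) (dotProduct_eq_zero _ fun w => ?_)
  · simpa [symp_apply, dotProduct_comm] using h (0, w)
  · simpa [symp_apply] using h (w, 0)

variable [DecidableEq Q]

theorem weyl_zero : weyl (0 : Phase D Q) = 1 := by
  ext i j
  simp [weyl_apply, Matrix.one_apply, eq_comm]

theorem weyl_mul_weyl (u v : Phase D Q) :
    weyl u * weyl v = chi D (-(u.2 ⬝ᵥ v.1)) • weyl (u + v) := by
  ext i j
  rw [Matrix.mul_apply, Finset.sum_eq_single (i + u.1) (fun b _ hb => by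
    rw [weyl_apply, if_neg hb, zero_mul]) (by simp)]
  simp only [weyl_apply, Matrix.smul_apply, if_true, mul_ite, mul_zero, smul_eq_mul, Prod.fst_add,
    Prod.snd_add, add_assoc]
  split_ifs with h
  · rw [← AddChar.map_add_eq_mul, ← AddChar.map_add_eq_mul, h]
    congr 1
    simp only [dotProduct_add, add_dotProduct]
    ring
  · rfl

theorem weyl_comm (u v : Phase D Q) :
    weyl u * weyl v = chi D (symp D Q u v) • (weyl v * weyl u) := by
  rw [weyl_mul_weyl, weyl_mul_weyl, smul_smul, ← AddChar.map_add_eq_mul, add_comm v u, symp_apply]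
  congr 2
  ring

theorem weyl_conjTranspose_mul_self (u : Phase D Q) : (weyl u)ᴴ * weyl u = 1 := by
  ext i j
  simp only [Matrix.mul_apply, weyl_apply, Matrix.conjTranspose_apply]
  rw [Finset.sum_eq_single (i - u.1)]
  · by_cases h : i = j
    · subst h
      simp [star_chi, ← AddChar.map_add_eq_mul]
    · simp [h, Ne.symm h, Matrix.one_apply]
  · intro b _ hb
    rw [if_neg (fun h => hb (by rw [h, add_sub_cancel_right])), star_zero, zero_mul]
  · simp

theorem exists_weyl_pow (u : Phase D Q) (m : ℕ) :
    ∃ c : ℂ, star c * c = 1 ∧ weyl u ^ m = c • weyl (m • u) := by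
  induction m with
  | zero => exact ⟨1, by simp [weyl_zero]⟩
  | succ m ih =>
    obtain ⟨c, hc, h⟩ := ih
    refine ⟨c * chi D (-((m • u).2 ⬝ᵥ u.1)), ?_, ?_⟩
    · rw [star_mul', mul_mul_mul_comm, hc, star_chi, ← AddChar.map_add_eq_mul]
      simp
    · rw [pow_succ, h, Matrix.smul_mul, weyl_mul_weyl, smul_smul, succ_nsmul]

/-- Since `D • u = 0`, only a phase survives. It need not be 1: for `D = 2` the square of `XZ` is
`-1`. This is why Weyl operators are rescaled in `IsNormWeyl`. -/
theorem exists_weyl_pow_self (u : Phase D Q) :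
    ∃ c : ℂ, star c * c = 1 ∧ weyl u ^ D = c • (1 : Op (Cfg D Q)) := by
  obtain ⟨c, hc, h⟩ := exists_weyl_pow u D
  refine ⟨c, hc, ?_⟩
  rw [h, ← weyl_zero, ← Nat.cast_smul_eq_nsmul (ZMod D), CharP.cast_eq_zero, zero_smul]

/-! ### Pauli products as multiples of Weyl operators -/

theorem chi_eq_omega_pow (a : ZMod D) : chi D a = omega D ^ a.val := by
  conv_lhs => rw [← ZMod.natCast_zmod_val a, ← Int.cast_natCast, ZMod.stdAddChar_coe]
  rw [omega, ← Complex.exp_nat_mul]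
  congr 1
  push_cast
  ring

theorem pauliX_pow (m : ℕ) (i j : ZMod D) :
    (pauliX D ^ m) i j = if j = i + m then 1 else 0 := by
  induction m generalizing i j with
  | zero => simp [Matrix.one_apply, eq_comm]
  | succ m ih =>
    rw [pow_succ, Matrix.mul_apply]
    simp only [ih]
    simp only [pauliX, Matrix.of_apply, ite_mul, one_mul, zero_mul, Finset.sum_ite_eq',
      Finset.sum_ite_eq, Finset.mem_univ, if_true, Nat.cast_succ, add_assoc]

theorem pauliZ_pow (a : ZMod D) :
    pauliZ D ^ a.val = Matrix.diagonal fun j => chi D (a * j) := by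
  rw [pauliZ, Matrix.diagonal_pow]
  congr 1
  ext j
  rw [Pi.pow_apply, ← chi_eq_omega_pow, ← AddChar.map_nsmul_eq_pow, nsmul_eq_mul,
    ZMod.natCast_zmod_val]

theorem pauliProduct_eq (γ : ZMod (2 * D)) (x z : Q → ZMod D) :
    pauliProduct D γ x z = lam D ^ γ.val • weyl (x, z) := by
  ext i j
  simp only [pauliProduct, Matrix.of_apply, Matrix.smul_apply, smul_eq_mul, weyl_apply]
  congr 1
  simp only [pauliZ_pow, Matrix.mul_diagonal, pauliX_pow, ZMod.natCast_zmod_val, ite_mul, one_mul,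
    zero_mul, Finset.prod_ite_zero, funext_iff, Pi.add_apply, Finset.mem_univ, true_implies,
    dotProduct]
  split_ifs with h
  · exact (map_sum_chi _).symm
  · rfl

end Weyl

/-- The restrictions of a phase space point to the two parts of a bipartition. -/
def phaseRestrict {D n : ℕ} (p : Fin n → Prop) (u : Phase D (Fin n)) : Phase D {q // p q} :=
  (fun q => u.1 q, fun q => u.2 q)

/-- Both the shift condition and the exponent `u.2 ⬝ᵥ j` are collected qudit by qudit, so they split
over `B` and its complement. -/
theorem weyl_submatrix {D n : ℕ} [Fact D.Prime] (B : Finset (Fin n)) (u : Phase D (Fin n)) :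
    (weyl u).submatrix (Equiv.piEquivPiSubtypeProd (fun q => q ∈ B) (fun _ => ZMod D)).symm
      (Equiv.piEquivPiSubtypeProd (fun q => q ∈ B) (fun _ => ZMod D)).symm =
    weyl (phaseRestrict (fun q => q ∈ B) u) ⊗ₖ weyl (phaseRestrict (fun q => q ∉ B) u) := by
  set e := Equiv.piEquivPiSubtypeProd (fun q => q ∈ B) (fun _ => ZMod D)
  ext i j
  obtain ⟨i, rfl⟩ := e.surjective i
  obtain ⟨j, rfl⟩ := e.surjective j
  have hiff : j = i + u.1 ↔ (e j).1 = (e i).1 + (phaseRestrict (fun q => q ∈ B) u).1 ∧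
      (e j).2 = (e i).2 + (phaseRestrict (fun q => q ∉ B) u).1 := by
    rw [← e.apply_eq_iff_eq, Prod.ext_iff]
    rfl
  simp only [Matrix.submatrix_apply, Equiv.symm_apply_apply, Matrix.kroneckerMap_apply, weyl_apply,
    ite_mul, mul_ite, zero_mul, mul_zero, hiff, ite_and]
  split_ifs
  · rw [← AddChar.map_add_eq_mul]
    congr 1
    have := Fintype.sum_subtype_add_sum_subtype (fun q => q ∈ B) (fun q => u.2 q * j q)
    simp only [dotProduct]
    rw [← this]
    congr!
  all_goals rfl

/-! ### Symplectic linear algebra -/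

section SymplecticFamily

variable {F W : Type} [Field F] [AddCommGroup W] [Module F W]

theorem isAlt_swap {β : LinearMap.BilinForm F W} (hβ : β.IsAlt) (u v : W) : β u v = -β v u :=
  (LinearMap.IsAlt.neg hβ v u).symm

/-- A family of hyperbolic pairs `(z t, x t)` which are mutually orthogonal. -/
structure IsSympFam (β : LinearMap.BilinForm F W) {T : Type} [DecidableEq T] (z x : T → W) :
    Prop where
  zz : ∀ s t, β (z s) (z t) = 0
  xx : ∀ s t, β (x s) (x t) = 0
  zx : ∀ s t, β (z s) (x t) = if s = t then 1 else 0

variable {β : LinearMap.BilinForm F W} {T : Type} [Fintype T] [DecidableEq T] {z x : T → W}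

/-- The component of `v` orthogonal to the hyperbolic pairs `(z t, x t)`. -/
def sympProj (β : LinearMap.BilinForm F W) (z x : T → W) (v : W) : W :=
  v - ∑ t, β v (x t) • z t + ∑ t, β v (z t) • x t

theorem IsSympFam.xz (h : IsSympFam β z x) (hβ : β.IsAlt) (s t : T) :
    β (x s) (z t) = if s = t then -1 else 0 := by
  rw [isAlt_swap hβ, h.zx]
  split_ifs <;> simp_all

theorem sympProj_left_z (h : IsSympFam β z x) (hβ : β.IsAlt) (v : W) (t : T) :
    β (sympProj β z x v) (z t) = 0 := by
  simp [sympProj, h.zz, h.xz hβ]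

theorem sympProj_left_x (h : IsSympFam β z x) (v : W) (t : T) :
    β (sympProj β z x v) (x t) = 0 := by
  simp [sympProj, h.xx, h.zx]

theorem apply_sympProj {u : W} (hz : ∀ t, β u (z t) = 0) (hx : ∀ t, β u (x t) = 0) (v : W) :
    β u (sympProj β z x v) = β u v := by
  simp [sympProj, hx, hz]

/-- Pairing a linear relation with each `x t` and each `z t` isolates its coefficients, so the
family is independent. The bound is what stops the greedy extension below. -/
theorem IsSympFam.two_mul_card_le [FiniteDimensional F W] (h : IsSympFam β z x) (hβ : β.IsAlt) :
    2 * Fintype.card T ≤ Module.finrank F W := by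
  have hli : LinearIndependent F (Sum.elim z x) := by
    rw [Fintype.linearIndependent_iff]
    intro g hg
    rw [Fintype.sum_sum_type] at hg
    simp only [Sum.elim_inl, Sum.elim_inr] at hg
    have h1 := fun t => congrArg (fun w => β w (x t)) hg
    have h2 := fun t => congrArg (fun w => β w (z t)) hg
    simp [h.zx, h.xx] at h1
    simp [h.zz, h.xz hβ] at h2
    rintro (t | t)
    exacts [h1 t, h2 t]
  have := hli.fintype_card_le_finrank
  rw [Fintype.card_sum] at this
  omega

theorem IsSympFam.sumElim {S : Type} [DecidableEq S] {z' x' : S → W} (hβ : β.IsAlt)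
    (h : IsSympFam β z x) (h' : IsSympFam β z' x')
    (hzz : ∀ s t, β (z s) (z' t) = 0) (hzx : ∀ s t, β (z s) (x' t) = 0)
    (hxz : ∀ s t, β (x s) (z' t) = 0) (hxx : ∀ s t, β (x s) (x' t) = 0) :
    IsSympFam β (Sum.elim z z') (Sum.elim x x') := by
  have hzz' : ∀ s t, β (z' t) (z s) = 0 := fun s t => by rw [isAlt_swap hβ, hzz, neg_zero]
  have hxx' : ∀ s t, β (x' t) (x s) = 0 := fun s t => by rw [isAlt_swap hβ, hxx, neg_zero]
  have hzx' : ∀ s t, β (z' t) (x s) = 0 := fun s t => by rw [isAlt_swap hβ, hxz, neg_zero]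
  constructor <;> rintro (s | s) (t | t) <;> simp [h.zz, h.xx, h.zx, h'.zz, h'.xx, h'.zx, *]

/-- Every family of hyperbolic pairs extends to a maximal one. -/
theorem IsSympFam.exists_maximal [FiniteDimensional F W] (hβ : β.IsAlt) (h : IsSympFam β z x) :
    ∃ (p : ℕ) (z' x' : Fin p → W), IsSympFam β (Sum.elim z z') (Sum.elim x x') ∧
      ∀ v, (∀ t, β v (Sum.elim z z' t) = 0) → (∀ t, β v (Sum.elim x x' t) = 0) → ∀ w, β v w = 0 := by
  classical
  let P : ℕ → Prop := fun p =>
    ∃ z' x' : Fin p → W, IsSympFam β (Sum.elim z z') (Sum.elim x x')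
  have hP0 : P 0 := by
    refine ⟨Fin.elim0, Fin.elim0, h.sumElim hβ ?_ ?_ ?_ ?_ ?_⟩
    · constructor <;> intro s <;> exact s.elim0
    all_goals exact fun _ s => s.elim0
  have hb : ∀ p, P p → p ≤ Module.finrank F W := by
    rintro p ⟨z', x', h'⟩
    have := h'.two_mul_card_le hβ
    rw [Fintype.card_sum, Fintype.card_fin] at this
    omega
  have hspec := Nat.findGreatest_spec (P := P) (Nat.zero_le (Module.finrank F W)) hP0
  set p := Nat.findGreatest P (Module.finrank F W) with hp
  obtain ⟨z', x', h'⟩ := hspec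
  refine ⟨p, z', x', h', fun v hz hx w => ?_⟩
  by_contra hvw
  have hmax : ¬ P (p + 1) := fun hP => by
    have := Nat.le_findGreatest (hb _ hP) hP
    omega
  apply hmax
  -- If `v` paired nontrivially with some `w`, projecting `w` off the family and rescaling would
  -- give `v` a partner, and the pair `(v, y)` would enlarge a family of maximal size.
  set y := (β v w)⁻¹ • sympProj β (Sum.elim z z') (Sum.elim x x') w with hy
  have hvy : β v y = 1 := by
    rw [hy, map_smul, apply_sympProj hz hx, smul_eq_mul, inv_mul_cancel₀ hvw]
  have hyv : β y v = -1 := by rw [isAlt_swap hβ, hvy]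
  have hyz : ∀ t, β y (Sum.elim z z' t) = 0 := fun t => by
    rw [hy, map_smul, LinearMap.smul_apply, sympProj_left_z h' hβ, smul_zero]
  have hyx : ∀ t, β y (Sum.elim x x' t) = 0 := fun t => by
    rw [hy, map_smul, LinearMap.smul_apply, sympProj_left_x h', smul_zero]
  -- Prepending at index 0 of `Fin (p + 1)` is a reindexing of the sum with `Unit`; the relations
  -- pull back along it because it is injective.
  have hcons : ∀ (f : T → W) (f' : Fin p → W) (u : W), Sum.elim f (Fin.cons u f' : Fin (p+1) → W) =
      Sum.elim (Sum.elim f f') (fun _ : Unit => u) ∘ fun t : T ⊕ Fin (p + 1) =>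
        t.elim (fun t => .inl (.inl t)) (Fin.cons (.inr ()) fun i => .inl (.inr i)) := by
    intro f f' u
    ext t
    rcases t with t | t
    · rfl
    · induction t using Fin.cases <;> rfl
  have hinj : Function.Injective fun t : T ⊕ Fin (p + 1) =>
      (t.elim (fun t => .inl (.inl t)) (Fin.cons (.inr ()) fun i => .inl (.inr i)) :
        (T ⊕ Fin p) ⊕ Unit) := by
    rintro (s | s) (t | t)
    · simp
    · induction t using Fin.cases <;> simp
    · induction s using Fin.cases <;> simp
    · induction s using Fin.cases <;> induction t using Fin.cases <;> simp
  have hnew : IsSympFam β (Sum.elim (Sum.elim z z') (fun _ : Unit => v))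
      (Sum.elim (Sum.elim x x') (fun _ : Unit => y)) := by
    refine h'.sumElim hβ ⟨?_, ?_, ?_⟩ ?_ ?_ ?_ ?_
    · exact fun _ _ => hβ v
    · exact fun _ _ => hβ y
    · exact fun _ _ => by simp [hvy]
    · exact fun s _ => by rw [isAlt_swap hβ, hz, neg_zero]
    · exact fun s _ => by rw [isAlt_swap hβ, hyz, neg_zero]
    · exact fun s _ => by rw [isAlt_swap hβ, hx, neg_zero]
    · exact fun s _ => by rw [isAlt_swap hβ, hyx, neg_zero]
  refine ⟨Fin.cons v z', Fin.cons y x', ?_⟩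
  rw [hcons, hcons]
  refine ⟨fun s t => hnew.zz _ _, fun s t => hnew.xx _ _, fun s t => ?_⟩
  rw [Function.comp, Function.comp, hnew.zx]
  simp only [hinj.eq_iff]

/-- For a nondegenerate form a maximal family spans: the projection of any vector off the family
lies in the radical, so it vanishes. Spanning gives one inequality for the dimension and
independence the other. -/
theorem IsSympFam.exists_complete [FiniteDimensional F W] (hβ : β.IsAlt)
    (hnd : ∀ u, (∀ v, β u v = 0) → u = 0) (h : IsSympFam β z x) :
    ∃ (p : ℕ) (z' x' : Fin p → W), IsSympFam β (Sum.elim z z') (Sum.elim x x') ∧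
      Module.finrank F W = 2 * (Fintype.card T + p) := by
  obtain ⟨p, z', x', h', hmax⟩ := h.exists_maximal hβ
  refine ⟨p, z', x', h', le_antisymm ?_ ?_⟩
  · have hspan : (⊤ : Submodule F W) ≤
        Submodule.span F (Set.range (Sum.elim (Sum.elim z z') (Sum.elim x x'))) := by
      intro v _
      have h0 : sympProj β (Sum.elim z z') (Sum.elim x x') v = 0 :=
        hnd _ (hmax _ (sympProj_left_z h' hβ v) (sympProj_left_x h' v))
      rw [sympProj] at h0
      have hv : v = ∑ t, β v (Sum.elim x x' t) • Sum.elim z z' t -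
          ∑ t, β v (Sum.elim z z' t) • Sum.elim x x' t := by
        rw [← sub_eq_zero, ← h0]
        abel
      rw [hv]
      refine Submodule.sub_mem _ (Submodule.sum_mem _ fun t _ => Submodule.smul_mem _ _ ?_)
        (Submodule.sum_mem _ fun t _ => Submodule.smul_mem _ _ ?_)
      · exact Submodule.subset_span ⟨.inl t, rfl⟩
      · exact Submodule.subset_span ⟨.inr t, rfl⟩
    have := finrank_range_le_card (R := F) (Sum.elim (Sum.elim z z') (Sum.elim x x'))
    rw [Set.finrank, top_le_iff.mp hspan, finrank_top] at this
    simp only [Fintype.card_sum, Fintype.card_fin] at this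
    omega
  · simpa using h'.two_mul_card_le hβ

/-- An isotropic independent family orthogonal to a family of hyperbolic pairs can be completed
to a family of hyperbolic pairs. -/
theorem IsSympFam.exists_partners [FiniteDimensional F W] (hβ : β.IsAlt)
    (hnd : ∀ u, (∀ v, β u v = 0) → u = 0) (h : IsSympFam β z x)
    {N : Type} [Fintype N] [DecidableEq N] {y : N → W} (hy : LinearIndependent F y)
    (hyy : ∀ s t, β (y s) (y t) = 0) (hyz : ∀ s t, β (y s) (z t) = 0)
    (hyx : ∀ s t, β (y s) (x t) = 0) :
    ∃ y' : N → W, IsSympFam β (Sum.elim y z) (Sum.elim y' x) := by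
  have hβnd : β.Nondegenerate := by
    refine ⟨fun u hu => hnd u hu, fun u hu => hnd u fun v => ?_⟩
    rw [isAlt_swap hβ, hu, neg_zero]
  have hdual : ∀ t, ∃ v, ∀ s, β (y s) v = if s = t then 1 else 0 := by
    intro t
    obtain ⟨f, hf⟩ : ∃ f : W →ₗ[F] F, ∀ s, f (y s) = if s = t then 1 else 0 := by
      let b := Module.Basis.sumExtend hy
      refine ⟨b.constr F (Sum.elim (fun s => if s = t then 1 else 0) 0), fun s => ?_⟩
      have : y s = b (.inl s) := by
        simp [b, Module.Basis.sumExtend]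
        rfl
      rw [this, Module.Basis.constr_basis, Sum.elim_inl]
    -- `toDual` represents `f` through the left argument of `β`; the sign moves it to the right
    -- argument.
    refine ⟨-(LinearMap.BilinForm.toDual β hβnd).symm f, fun s => ?_⟩
    rw [map_neg, ← isAlt_swap hβ, LinearMap.BilinForm.apply_toDual_symm_apply, hf]
  choose d hd using hdual
  let e : N → W := fun t => sympProj β z x (d t)
  have he : ∀ s t, β (y s) (e t) = if s = t then 1 else 0 := fun s t => by
    rw [apply_sympProj (hyz s) (hyx s), hd]
  have he' : ∀ s t, β (e t) (y s) = if s = t then -1 else 0 := fun s t => by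
    rw [isAlt_swap hβ, he, apply_ite Neg.neg, neg_zero]
  have hez : ∀ s t, β (e s) (z t) = 0 := fun s t => sympProj_left_z h hβ _ _
  have hex : ∀ s t, β (e s) (x t) = 0 := fun s t => sympProj_left_x h _ _
  let o := Fintype.equivFin N
  -- The dual vectors `e` need not be mutually orthogonal. Correcting each `e t` only by the earlier
  -- `y s` is enough, whereas a symmetric correction would need a factor 1/2, absent in
  -- characteristic 2.
  refine ⟨fun t => e t + ∑ s, (if o s < o t then β (e s) (e t) else 0) • y s,
    IsSympFam.sumElim hβ ⟨hyy, fun s t => ?_, fun s t => ?_⟩ h hyz hyx (fun s t => ?_)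
      fun s t => ?_⟩
  · simp only [map_add, map_sum, map_smul, LinearMap.add_apply, LinearMap.sum_apply,
      LinearMap.smul_apply, he, he', hyy, smul_eq_mul, mul_ite, mul_zero, mul_one, mul_neg,
      Finset.sum_ite_eq, Finset.sum_ite_eq', Finset.mem_univ, if_true, Finset.sum_const_zero,
      add_zero]
    rcases lt_trichotomy (o s) (o t) with hlt | heq | hlt
    · simp [hlt, hlt.not_gt]
    · obtain rfl := o.injective heq
      simp [hβ (e s)]
    · rw [if_neg hlt.not_gt, if_pos hlt, isAlt_swap hβ (e s)]
      ring
  · simp only [map_add, map_sum, map_smul, he, hyy, smul_zero, Finset.sum_const_zero, add_zero]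
  · simp only [map_add, map_sum, map_smul, LinearMap.add_apply, LinearMap.sum_apply,
      LinearMap.smul_apply, hez, hyz, smul_zero, Finset.sum_const_zero, add_zero]
  · simp only [map_add, map_sum, map_smul, LinearMap.add_apply, LinearMap.sum_apply,
      LinearMap.smul_apply, hex, hyx, smul_zero, Finset.sum_const_zero, add_zero]

/-- Completion of a partial symplectic basis: hyperbolic pairs `(z, x)` together with isotropic
`r` and `w` become part of a symplectic basis in which `r` are of `z` type and `w` of `x` type. -/
theorem exists_symplectic_basis [FiniteDimensional F W] (hβ : β.IsAlt)
    (hnd : ∀ u, (∀ v, β u v = 0) → u = 0) (h : IsSympFam β z x)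
    {I K : Type} [Fintype I] [DecidableEq I] [Fintype K] [DecidableEq K] {r : I → W} {w : K → W}
    (hrw : LinearIndependent F (Sum.elim r w))
    (hyy : ∀ s t, β (Sum.elim r w s) (Sum.elim r w t) = 0)
    (hyz : ∀ s t, β (Sum.elim r w s) (z t) = 0) (hyx : ∀ s t, β (Sum.elim r w s) (x t) = 0) :
    ∃ (p : ℕ) (z' x' : I ⊕ Fin p ⊕ T ⊕ K → W), IsSympFam β z' x' ∧
      Module.finrank F W = 2 * Fintype.card (I ⊕ Fin p ⊕ T ⊕ K) ∧
      (∀ i, z' (.inl i) = r i) ∧ (∀ t, z' (.inr (.inr (.inl t))) = z t) ∧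
      (∀ t, x' (.inr (.inr (.inl t))) = x t) ∧ (∀ k, x' (.inr (.inr (.inr k))) = w k) := by
  obtain ⟨y', hy'⟩ := h.exists_partners hβ hnd hrw hyy hyz hyx
  obtain ⟨p, z', x', h', hdim⟩ := hy'.exists_complete hβ hnd
  -- The `w` were completed as `z`-type vectors; negating their partners exchanges the two roles
  -- while keeping the pairing equal to 1.
  refine ⟨p, Sum.elim r (Sum.elim z' (Sum.elim z fun k => -y' (.inr k))),
    Sum.elim (fun i => y' (.inl i)) (Sum.elim x' (Sum.elim x w)), ?_, ?_, fun _ => rfl,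
    fun _ => rfl, fun _ => rfl, fun _ => rfl⟩
  · have hzz := fun s t => h'.zz s t
    have hxx := fun s t => h'.xx s t
    have hzx := fun s t => h'.zx s t
    have hxz := fun s t => h'.xz hβ s t
    simp only [Sum.forall, Sum.elim_inl, Sum.elim_inr, Sum.inl.injEq, Sum.inr.injEq, reduceCtorEq,
      if_false] at hzz hxx hzx hxz
    constructor <;> rintro (s | s | s | s) (t | t | t | t) <;> simp [hzz, hxx, hzx, hxz]
    split_ifs <;> simp
  · rw [hdim]
    simp only [Fintype.card_sum, Fintype.card_fin]
    ring

end SymplecticFamily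

/-- The hypothesis contains two facts at once: `f` is injective, and its range meets `P` only in 0.
-/
theorem linearIndependent_sumElim_of_forall {F U W ι κ : Type} [Field F] [AddCommGroup U]
    [Module F U] [AddCommGroup W] [Module F W] (f : U →ₗ[F] W) {P : Submodule F W}
    (b : Module.Basis ι F U) (c : Module.Basis κ F P) (h : ∀ u, f u ∈ P → u = 0) :
    LinearIndependent F (Sum.elim (fun i => f (b i)) (fun i => (c i : W))) := by
  have hker : LinearMap.ker f = ⊥ :=
    LinearMap.ker_eq_bot'.mpr fun u hu => h u (by rw [hu]; exact P.zero_mem)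
  refine (b.linearIndependent.map' f hker).sum_type (c.linearIndependent.map' P.subtype
    (Submodule.ker_subtype P)) ?_
  rw [Submodule.disjoint_def]
  intro w hw hw'
  have h1 : Submodule.span F (Set.range (f ∘ b)) ≤ LinearMap.range f := by
    rw [Submodule.span_le]
    rintro _ ⟨i, rfl⟩
    exact ⟨b i, rfl⟩
  have h2 : Submodule.span F (Set.range (P.subtype ∘ c)) ≤ P := by
    rw [Submodule.span_le]
    rintro _ ⟨i, rfl⟩
    exact (c i).2
  obtain ⟨u, rfl⟩ := h1 hw
  rw [h u (h2 hw'), map_zero]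

/-- A normal form for an isotropic subspace `L` of an orthogonal sum of two symplectic spaces:
`L` is spanned by hyperbolic pairs `(z, x)` for the first form, by elements `r` orthogonal to `L`
in both forms, and by elements `w`, `w'` of the two summands. -/
theorem exists_isotropic_normal_form {F W W' : Type} [Field F] [AddCommGroup W] [Module F W]
    [AddCommGroup W'] [Module F W'] [FiniteDimensional F W] [FiniteDimensional F W']
    {β : LinearMap.BilinForm F W} {β' : LinearMap.BilinForm F W'} (hβ : β.IsAlt)
    (L : Submodule F (W × W')) (hL : ∀ l ∈ L, ∀ l' ∈ L, β l.1 l'.1 + β' l.2 l'.2 = 0) :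
    ∃ (a b c c' : ℕ) (r : Fin a → W × W') (z x : Fin b → W × W') (w : Fin c → W)
      (w' : Fin c' → W'),
      (∀ i, r i ∈ L) ∧ (∀ i, z i ∈ L) ∧ (∀ i, x i ∈ L) ∧ (∀ i, (w i, 0) ∈ L) ∧
      (∀ i, (0, w' i) ∈ L) ∧
      (∀ N : Submodule F (W × W'), (∀ i, r i ∈ N) → (∀ i, z i ∈ N) → (∀ i, x i ∈ N) →
        (∀ i, (w i, 0) ∈ N) → (∀ i, (0, w' i) ∈ N) → L ≤ N) ∧
      IsSympFam β (fun i => (z i).1) (fun i => (x i).1) ∧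
      (∀ i, ∀ l ∈ L, β (r i).1 l.1 = 0) ∧
      LinearIndependent F (Sum.elim (fun i => (r i).1) w) ∧
      LinearIndependent F (Sum.elim (fun i => (r i).2) w') := by
  -- The form of the first summand alone, seen on `L`. It is usually degenerate, so a maximal family
  -- of hyperbolic pairs leaves its radical as remainder.
  let γ : LinearMap.BilinForm F L :=
    β.compl₁₂ (LinearMap.fst F W W' ∘ₗ L.subtype) (LinearMap.fst F W W' ∘ₗ L.subtype)
  have hγ : ∀ l m : L, γ l m = β l.1.1 m.1.1 := fun _ _ => rfl
  have hγalt : γ.IsAlt := fun l => hβ _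
  obtain ⟨b, z, x, hzx, hmax⟩ :=
    IsSympFam.exists_maximal (T := Empty) (z := fun t => t.elim) (x := fun t => t.elim) hγalt
      ⟨fun s => s.elim, fun s => s.elim, fun s => s.elim⟩
  have hzx' : IsSympFam γ z x :=
    ⟨fun s t => hzx.zz (.inr s) (.inr t), fun s t => hzx.xx (.inr s) (.inr t),
      fun s t => by simpa using hzx.zx (.inr s) (.inr t)⟩
  let Lw : Submodule F W := L.comap (LinearMap.inl F W W')
  let Lw' : Submodule F W' := L.comap (LinearMap.inr F W W')
  have hLww : ∀ l ∈ Lw.prod Lw', l ∈ L := fun l hl => by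
    simpa using L.add_mem (show (l.1, (0 : W')) ∈ L from hl.1) (show ((0 : W), l.2) ∈ L from hl.2)
  -- One-sided elements lie in the radical: for `(w, 0)` in `L` isotropy has no second term, and
  -- `(0, w')` does not enter `γ`.
  have hLwker : ∀ l (hl : l ∈ Lw.prod Lw'), γ ⟨l, hLww l hl⟩ = 0 := by
    intro l hl
    ext m
    have h1 : (l.1, (0 : W')) ∈ L := hl.1
    simpa [hγ] using hL _ h1 _ m.2
  -- Intersecting the radical with a complement `M` of the one-sided elements gives `R`, a
  -- complement of them inside the radical.
  obtain ⟨M, hM⟩ := Submodule.exists_isCompl (Lw.prod Lw')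
  obtain ⟨R, hR⟩ : ∃ R : Submodule F (W × W'), ∀ l, l ∈ R ↔ (∃ h : l ∈ L, γ ⟨l, h⟩ = 0) ∧ l ∈ M :=
    ⟨(LinearMap.ker γ).map L.subtype ⊓ M, fun l => by simp⟩
  let br := Module.finBasis F R
  let bw := Module.finBasis F Lw
  let bw' := Module.finBasis F Lw'
  have hspan : ∀ (V : Type) [AddCommGroup V] [Module F V] (P : Submodule F V)
      (n : ℕ) (bb : Module.Basis (Fin n) F P) (N : Submodule F V),
      (∀ i, (bb i : V) ∈ N) → P ≤ N := by
    intro V _ _ P n bb N h v hv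
    have := bb.sum_repr ⟨v, hv⟩
    have h2 := congrArg Subtype.val this
    simp only [Submodule.coe_sum, Submodule.coe_smul] at h2
    rw [← h2]
    exact Submodule.sum_mem _ fun i _ => Submodule.smul_mem _ _ (h i)
  have key : ∀ ρ : R, (ρ : W × W') ∈ Lw.prod Lw' → ρ = 0 := by
    intro ρ h
    have : (ρ : W × W') ∈ Lw.prod Lw' ⊓ M := ⟨h, ((hR _).mp ρ.2).2⟩
    rw [hM.inf_eq_bot] at this
    exact Subtype.ext this
  have hRL : ∀ ρ : R, (ρ : W × W') ∈ L := fun ρ => ((hR _).mp ρ.2).1.1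
  refine ⟨_, b, _, _, fun i => br i, fun i => z i, fun i => x i, fun i => bw i,
    fun i => bw' i, fun i => hRL _, fun i => (z i).2, fun i => (x i).2, fun i => (bw i).2,
    fun i => (bw' i).2, ?_, ?_, ?_, ?_, ?_⟩
  · intro N hr hz hx hw hw' l hl
    set l₀ : L := sympProj γ z x ⟨l, hl⟩ with hl₀
    have hker : γ l₀ = 0 := by
      ext m
      refine hmax l₀ ?_ ?_ m
      · rintro (t | t)
        exacts [t.elim, sympProj_left_z hzx' hγalt _ t]
      · rintro (t | t)
        exacts [t.elim, sympProj_left_x hzx' _ t]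
    obtain ⟨u, hu, v, hv, huv⟩ := Submodule.mem_sup.mp
      (show (l₀ : W × W') ∈ Lw.prod Lw' ⊔ M by rw [hM.sup_eq_top]; trivial)
    have hvR : v ∈ R := by
      have hvl : v = l₀ - u := by rw [← huv]; abel
      have hvL : v ∈ L := hvl ▸ L.sub_mem l₀.2 (hLww u hu)
      refine (hR v).mpr ⟨⟨hvL, ?_⟩, hv⟩
      have : (⟨v, hvL⟩ : L) = l₀ - ⟨u, hLww u hu⟩ := Subtype.ext hvl
      rw [this, map_sub, hker, hLwker u hu, sub_zero]
    have hvN : v ∈ N := hspan _ R _ br N hr hvR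
    have huN : u ∈ N := by
      have h1 : (u.1, (0 : W')) ∈ N :=
        hspan W Lw _ bw (N.comap (LinearMap.inl F W W')) hw hu.1
      have h2 : ((0 : W), u.2) ∈ N :=
        hspan W' Lw' _ bw' (N.comap (LinearMap.inr F W W')) hw' hu.2
      simpa using N.add_mem h1 h2
    have hl₀N : (l₀ : W × W') ∈ N := by
      rw [← huv]
      exact N.add_mem huN hvN
    have hl' : (⟨l, hl⟩ : L) = l₀ + ∑ t, γ ⟨l, hl⟩ (x t) • z t - ∑ t, γ ⟨l, hl⟩ (z t) • x t := by
      rw [hl₀, sympProj]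
      abel
    have := congrArg Subtype.val hl'
    simp only [Submodule.coe_sub, Submodule.coe_add, Submodule.coe_sum, Submodule.coe_smul] at this
    rw [this]
    exact N.sub_mem (N.add_mem hl₀N (N.sum_mem fun i _ => N.smul_mem _ (hz i)))
      (N.sum_mem fun i _ => N.smul_mem _ (hx i))
  · exact ⟨fun s t => hzx'.zz s t, fun s t => hzx'.xx s t, fun s t => hzx'.zx s t⟩
  · intro i l hl
    exact LinearMap.congr_fun ((hR _).mp (br i).2).1.2 ⟨l, hl⟩
  -- If `(ρ.1, 0)` lies in `L`, so does the difference `(0, ρ.2)`; then `ρ` is a sum of one-sided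
  -- elements and `key` forces it to vanish.
  · refine linearIndependent_sumElim_of_forall (LinearMap.fst F W W' ∘ₗ R.subtype)
      br bw fun ρ h => key ρ ?_
    have h1 : ((ρ : W × W').1, (0 : W')) ∈ L := h
    refine ⟨h1, ?_⟩
    have := L.sub_mem (hRL ρ) h1
    simpa [Lw', Prod.sub_def] using this
  · refine linearIndependent_sumElim_of_forall (LinearMap.snd F W W' ∘ₗ R.subtype)
      br bw' fun ρ h => key ρ ?_
    have h1 : ((0 : W), (ρ : W × W').2) ∈ L := h
    refine ⟨?_, h1⟩
    have := L.sub_mem (hRL ρ) h1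
    simpa [Lw, Prod.sub_def] using this

/-! ### Frames for the Weyl relations -/

theorem pow_val_add {D : ℕ} [NeZero D] {M : Type} [Monoid M] {m : M} (hm : m ^ D = 1)
    (a b : ZMod D) : m ^ (a + b).val = m ^ a.val * m ^ b.val := by
  rw [ZMod.val_add, ← pow_eq_pow_mod _ hm, pow_add]

section Frame

variable {D : ℕ} [Fact D.Prime] {α : Type} [Fintype α] [DecidableEq α]

/-- The Fourier components of the orbit of `v` under `m` are eigenvectors or zero and sum to `D •
v`, so one is nonzero. Exhibiting it as a combination of the `m ^ k *ᵥ v` matters: operators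
commuting with `m` keep `v`'s eigenvalues on it, which allows induction to a joint eigenvector. -/
theorem exists_eigenvector_of_pow_eq_one {m : Op α} (hm : m ^ D = 1) {v : α → ℂ} (hv : v ≠ 0) :
    ∃ a : ZMod D, ∃ c : ZMod D → ℂ, ∑ k, c k • (m ^ k.val *ᵥ v) ≠ 0 ∧
      m *ᵥ ∑ k, c k • (m ^ k.val *ᵥ v) = chi D a • ∑ k, c k • (m ^ k.val *ᵥ v) := by
  let w : ZMod D → α → ℂ := fun a => ∑ k, chi D (a * -k) • (m ^ k.val *ᵥ v)
  have hw : ∀ a, m *ᵥ w a = chi D a • w a := by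
    intro a
    simp only [w, Matrix.mulVec_sum, Finset.smul_sum, Matrix.mulVec_smul, Matrix.mulVec_mulVec,
      smul_smul, ← AddChar.map_add_eq_mul]
    refine Fintype.sum_equiv (Equiv.addRight 1) _ _ fun k => ?_
    simp only [Equiv.coe_addRight]
    rw [add_comm k 1, pow_val_add hm, ZMod.val_one, pow_one]
    congr 2
    ring
  have hsum : ∑ a, w a = (D : ℂ) • v := by
    simp only [w]
    rw [Finset.sum_comm]
    simp only [← Finset.sum_smul]
    rw [Finset.sum_eq_single 0]
    · simp
    · intro k _ hk
      rw [AddChar.sum_mulShift _ (ZMod.isPrimitive_stdAddChar D), if_neg (neg_ne_zero.mpr hk),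
        Nat.cast_zero, zero_smul]
    · simp
  obtain ⟨a, ha⟩ : ∃ a, w a ≠ 0 := by
    by_contra! h
    rw [Finset.sum_eq_zero fun a _ => h a, eq_comm, smul_eq_zero] at hsum
    exact hsum.elim (Nat.cast_ne_zero.mpr (NeZero.ne D)) hv
  exact ⟨a, _, ha, hw a⟩

variable {T : Type} [Fintype T] [DecidableEq T]

theorem exists_joint_eigenvector [Nonempty α] {z : T → Op α} (hz : ∀ t, z t ^ D = 1)
    (hzz : ∀ s t, z s * z t = z t * z s) :
    ∃ v : α → ℂ, v ≠ 0 ∧ ∃ a : T → ZMod D, ∀ t, z t *ᵥ v = chi D (a t) • v := by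
  suffices h : ∀ S : Finset T, ∃ v : α → ℂ, v ≠ 0 ∧ ∃ a : T → ZMod D, ∀ t ∈ S,
      z t *ᵥ v = chi D (a t) • v by
    obtain ⟨v, hv, a, ha⟩ := h Finset.univ
    exact ⟨v, hv, a, fun t => ha t (Finset.mem_univ t)⟩
  intro S
  induction S using Finset.induction_on with
  | empty => exact ⟨1, one_ne_zero, 0, by simp⟩
  | insert s S hs ih =>
    obtain ⟨v, hv, a, ha⟩ := ih
    obtain ⟨a', c, hw, hw'⟩ := exists_eigenvector_of_pow_eq_one (hz s) hv
    refine ⟨_, hw, Function.update a s a', fun t ht => ?_⟩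
    by_cases hts : t = s
    · subst hts
      rw [hw', Function.update_self]
    · rw [Function.update_of_ne hts, Matrix.mulVec_sum, Finset.smul_sum]
      refine Finset.sum_congr rfl fun k _ => ?_
      have hcomm : z t * z s ^ k.val = z s ^ k.val * z t :=
        ((show Commute (z t) (z s) from hzz t s).pow_right _).eq
      rw [Matrix.mulVec_smul, Matrix.mulVec_mulVec, hcomm, ← Matrix.mulVec_mulVec,
        ha t (Finset.mem_of_mem_insert_of_ne ht hts), Matrix.mulVec_smul, smul_comm]

theorem dotProduct_star_mulVec_of_unitary {u : Op α} (hu : uᴴ * u = 1) (v w : α → ℂ) :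
    star (u *ᵥ v) ⬝ᵥ (u *ᵥ w) = star v ⬝ᵥ w := by
  rw [Matrix.star_mulVec, Matrix.dotProduct_mulVec, Matrix.vecMul_vecMul, hu, Matrix.vecMul_one]

/-- Commuting operators of order `D` define an action of `T → ZMod D`. -/
theorem exists_shift_action {x : T → Op α} (hx : ∀ t, x t ^ D = 1)
    (hxx : ∀ s t, x s * x t = x t * x s) :
    ∃ X : (T → ZMod D) → Op α, X 0 = 1 ∧ (∀ b c, X (b + c) = X b * X c) ∧
      ∀ t a, X (Pi.single t a) = x t ^ a.val := by
  let ϕ : T → Multiplicative (ZMod D) →* Op α := fun t =>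
    { toFun := fun k => x t ^ k.toAdd.val
      map_one' := by simp
      map_mul' := fun a b => pow_val_add (hx t) _ _ }
  have hϕ : Pairwise fun s t => ∀ a b, Commute (ϕ s a) (ϕ t b) := fun s t _ a b =>
    (show Commute (x s) (x t) from hxx s t).pow_pow _ _
  let Φ := MonoidHom.noncommPiCoprod ϕ hϕ
  refine ⟨fun b => Φ fun t => Multiplicative.ofAdd (b t), map_one Φ, fun b c => ?_, fun t a => ?_⟩
  · rw [← map_mul]
    rfl
  · have : (fun s => Multiplicative.ofAdd ((Pi.single t a : T → ZMod D) s)) =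
        Pi.mulSingle t (Multiplicative.ofAdd a) := by
      ext s
      by_cases h : s = t
      · subst h
        simp
      · simp [h]
    simp only [this]
    exact MonoidHom.noncommPiCoprod_mulSingle _ _ _

open scoped ComplexOrder in
/-- Finite Stone–von Neumann theorem: operators on `Q` qudits satisfying the Weyl relations of
`T` qudits, with `T` and `Q` equinumerous, are unitarily equivalent to the standard ones. -/
theorem exists_weyl_frame {Q : Type} [Fintype Q] [DecidableEq Q]
    (hcard : Fintype.card T = Fintype.card Q) {z x : T → Op (Cfg D Q)} (hz : ∀ t, z t ^ D = 1)
    (hx : ∀ t, x t ^ D = 1) (hzu : ∀ t, (z t)ᴴ * z t = 1) (hxu : ∀ t, (x t)ᴴ * x t = 1)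
    (hzz : ∀ s t, z s * z t = z t * z s) (hxx : ∀ s t, x s * x t = x t * x s)
    (hzx : ∀ s t, z s * x t = chi D (if s = t then 1 else 0) • (x t * z s)) :
    ∃ E : Matrix (Cfg D Q) (Cfg D T) ℂ, Eᴴ * E = 1 ∧ E * Eᴴ = 1 ∧
      (∀ t b, z t *ᵥ E.col b = chi D (b t) • E.col b) ∧
      ∀ t b, x t *ᵥ E.col b = E.col (b + Pi.single t 1) := by
  obtain ⟨v₀, hv₀, a, ha₀⟩ := exists_joint_eigenvector hz hzz
  obtain ⟨v, hv, ha⟩ : ∃ v : Cfg D Q → ℂ, star v ⬝ᵥ v = 1 ∧ ∀ t, z t *ᵥ v = chi D (a t) • v := by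
    have hpos : 0 < star v₀ ⬝ᵥ v₀ := Matrix.dotProduct_star_self_pos_iff.mpr hv₀
    obtain ⟨r, hr, hr'⟩ : ∃ r : ℝ, 0 < r ∧ (r : ℂ) = star v₀ ⬝ᵥ v₀ := by
      rw [Complex.lt_def] at hpos
      exact ⟨_, hpos.1, Complex.ext rfl hpos.2⟩
    refine ⟨((Real.sqrt r)⁻¹ : ℂ) • v₀, ?_, fun t => ?_⟩
    · rw [star_smul, smul_dotProduct, dotProduct_smul, ← hr']
      have h1 : (Real.sqrt r : ℂ) * Real.sqrt r = r := by
        rw [← Complex.ofReal_mul, Real.mul_self_sqrt hr.le]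
      have h2 : (Real.sqrt r : ℂ) ≠ 0 := Complex.ofReal_ne_zero.mpr (Real.sqrt_pos.mpr hr).ne'
      simp only [smul_eq_mul, star_inv₀, Complex.star_def, Complex.conj_ofReal]
      rw [← h1]
      field_simp
    · rw [Matrix.mulVec_smul, ha₀, smul_comm]
  obtain ⟨X, hX0, hXadd, hXs⟩ := exists_shift_action hx hxx
  have hind : ∀ p : (T → ZMod D) → Prop, p 0 → (∀ b c, p b → p c → p (b + c)) →
      (∀ t c, p (Pi.single t c)) → ∀ b, p b := by
    intro p h0 hadd hs b
    rw [← Finset.univ_sum_single b]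
    exact Finset.sum_induction _ p hadd h0 fun t _ => hs t _
  have hXu : ∀ b, (X b)ᴴ * X b = 1 := by
    refine hind _ (by simp [hX0]) (fun b c hb hc => ?_) fun t c => ?_
    · rw [hXadd, Matrix.conjTranspose_mul, Matrix.mul_assoc, ← Matrix.mul_assoc _ (X b), hb,
        Matrix.one_mul, hc]
    · rw [hXs]
      induction c.val with
      | zero => simp
      | succ m ih =>
        rw [pow_succ, Matrix.conjTranspose_mul, Matrix.mul_assoc, ← Matrix.mul_assoc _ (x t ^ m),
          ih, Matrix.one_mul, hxu]
  have hzX : ∀ s b, z s * X b = chi D (b s) • (X b * z s) := by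
    intro s
    refine hind _ (by simp [hX0]) (fun b c hb hc => ?_) fun t c => ?_
    · rw [hXadd, ← Matrix.mul_assoc, hb, Matrix.smul_mul, Matrix.mul_assoc, hc, Matrix.mul_smul,
        smul_smul, ← AddChar.map_add_eq_mul, ← Matrix.mul_assoc, Pi.add_apply]
    · rw [hXs]
      have : ∀ m : ℕ, z s * x t ^ m = chi D (m * if s = t then 1 else 0) • (x t ^ m * z s) := by
        intro m
        induction m with
        | zero => simp
        | succ m ih =>
          rw [pow_succ, ← Matrix.mul_assoc, ih, Matrix.smul_mul, Matrix.mul_assoc, hzx,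
            Matrix.mul_smul, smul_smul, ← AddChar.map_add_eq_mul, ← Matrix.mul_assoc]
          congr 2
          push_cast
          ring
      rw [this, ZMod.natCast_zmod_val, Pi.single_apply, mul_ite, mul_one, mul_zero]
  -- The start vector `v` has joint label `a` and `X (b - a)` raises labels by `b - a`, so column
  -- `b` carries the label `b`.
  let E : Matrix (Cfg D Q) (Cfg D T) ℂ := Matrix.of fun i b => (X (b - a) *ᵥ v) i
  have hE : ∀ b, E.col b = X (b - a) *ᵥ v := fun b => rfl
  have hzE : ∀ t b, z t *ᵥ E.col b = chi D (b t) • E.col b := by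
    intro t b
    rw [hE, Matrix.mulVec_mulVec, hzX, Matrix.smul_mulVec, ← Matrix.mulVec_mulVec, ha,
      Matrix.mulVec_smul, smul_smul, ← AddChar.map_add_eq_mul, Pi.sub_apply, sub_add_cancel]
  have hEE : Eᴴ * E = 1 := by
    ext b c
    have hbc : (Eᴴ * E) b c = star (E.col b) ⬝ᵥ E.col c := rfl
    rw [hbc]
    by_cases h : b = c
    · subst h
      rw [Matrix.one_apply_eq, hE, dotProduct_star_mulVec_of_unitary (hXu _), hv]
    · rw [Matrix.one_apply_ne h]
      -- A unitary `z t` preserves the inner product, yet multiplies it by a phase different from 1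
      -- when the labels differ at `t`; so it is zero.
      obtain ⟨t, ht⟩ := Function.ne_iff.mp h
      have h1 := dotProduct_star_mulVec_of_unitary (hzu t) (E.col b) (E.col c)
      rw [hzE, hzE, star_smul, smul_dotProduct, dotProduct_smul, star_chi, smul_smul,
        ← AddChar.map_add_eq_mul, smul_eq_mul] at h1
      by_contra h0
      rw [mul_eq_right₀ h0, chi_eq_one_iff, neg_add_eq_zero] at h1
      exact ht h1
  refine ⟨E, hEE, ?_, hzE, fun t b => ?_⟩
  · exact (Matrix.mul_eq_one_comm_of_card_eq _ _ _ (by simp [hcard])).mp hEE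
  · have hxt : x t = X (Pi.single t 1) := by rw [hXs, ZMod.val_one, pow_one]
    rw [hE, hE, Matrix.mulVec_mulVec, hxt, ← hXadd]
    congr 2
    abel

end Frame

/-! ### Normalized Weyl operators -/

section NormWeyl

variable {D : ℕ} [Fact D.Prime] {Q : Type} [Fintype Q] [DecidableEq Q]

/-- `M` is a multiple of the Weyl operator at `u`, of order dividing `D`. -/
def IsNormWeyl (u : Phase D Q) (M : Op (Cfg D Q)) : Prop :=
  (∃ c : ℂ, M = c • weyl u) ∧ M ^ D = 1

theorem exists_isNormWeyl (u : Phase D Q) : ∃ M, IsNormWeyl u M := by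
  obtain ⟨c, hc, h⟩ := exists_weyl_pow_self u
  obtain ⟨d, hd⟩ := IsAlgClosed.exists_pow_nat_eq c⁻¹ (Nat.pos_of_ne_zero (NeZero.ne D))
  have hc0 : c ≠ 0 := right_ne_zero_of_mul_eq_one hc
  exact ⟨d • weyl u, ⟨d, rfl⟩, by rw [smul_pow, h, hd, smul_smul, inv_mul_cancel₀ hc0, one_smul]⟩

theorem isNormWeyl_zero : IsNormWeyl (0 : Phase D Q) 1 :=
  ⟨⟨1, by rw [weyl_zero, one_smul]⟩, one_pow _⟩

theorem weyl_mul_conjTranspose_self (u : Phase D Q) : weyl u * (weyl u)ᴴ = 1 :=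
  mul_eq_one_comm.mp (weyl_conjTranspose_mul_self u)

theorem IsNormWeyl.conjTranspose_mul_self {u : Phase D Q} {M : Op (Cfg D Q)}
    (h : IsNormWeyl u M) : Mᴴ * M = 1 := by
  obtain ⟨⟨c, rfl⟩, h1⟩ := h
  obtain ⟨d, hd, hd'⟩ := exists_weyl_pow_self u
  rw [smul_pow, hd', smul_smul] at h1
  have h2 : c ^ D * d = 1 := by
    have := congrFun (congrFun h1 0) 0
    simpa using this
  have h3 : ‖d‖ = 1 := by
    have := congrArg norm hd
    rw [norm_mul, norm_star, norm_one] at this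
    nlinarith [norm_nonneg d]
  have h4 : ‖c‖ = 1 := by
    have := congrArg norm h2
    rw [norm_mul, h3, mul_one, norm_pow, norm_one] at this
    exact (pow_eq_one_iff_of_nonneg (norm_nonneg c) (NeZero.ne D)).mp this
  rw [Matrix.conjTranspose_smul, Matrix.smul_mul, Matrix.mul_smul, smul_smul,
    weyl_conjTranspose_mul_self]
  have : star c * c = 1 := by
    rw [Complex.star_def, ← Complex.normSq_eq_conj_mul_self, Complex.normSq_eq_norm_sq, h4]
    simp
  rw [this, one_smul]

theorem IsNormWeyl.mul_conjTranspose_self {u : Phase D Q} {M : Op (Cfg D Q)}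
    (h : IsNormWeyl u M) : M * Mᴴ = 1 :=
  mul_eq_one_comm.mp h.conjTranspose_mul_self

theorem exists_weyl_conjTranspose (u : Phase D Q) : ∃ c : ℂ, (weyl u)ᴴ = c • weyl (-u) := by
  refine ⟨chi D ((u.2 ⬝ᵥ (-u).1)), ?_⟩
  have h := weyl_mul_weyl u (-u)
  rw [add_neg_cancel, weyl_zero] at h
  have h2 := congrArg (fun A => (weyl u)ᴴ * A) h
  simp only [← Matrix.mul_assoc, weyl_conjTranspose_mul_self, Matrix.one_mul, Matrix.mul_smul,
    Matrix.mul_one] at h2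
  rw [h2, smul_smul, ← AddChar.map_add_eq_mul, add_neg_cancel, AddChar.map_zero_eq_one, one_smul]

theorem IsNormWeyl.conjTranspose {u : Phase D Q} {M : Op (Cfg D Q)} (h : IsNormWeyl u M) :
    IsNormWeyl (-u) Mᴴ := by
  refine ⟨?_, by rw [← Matrix.conjTranspose_pow, h.2, Matrix.conjTranspose_one]⟩
  obtain ⟨⟨c, rfl⟩, -⟩ := h
  obtain ⟨d, hd⟩ := exists_weyl_conjTranspose u
  exact ⟨star c * d, by rw [Matrix.conjTranspose_smul, hd, smul_smul]⟩

theorem IsNormWeyl.comm {u v : Phase D Q} {M N : Op (Cfg D Q)} (hM : IsNormWeyl u M)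
    (hN : IsNormWeyl v N) : M * N = chi D (symp D Q u v) • (N * M) := by
  obtain ⟨⟨c, rfl⟩, -⟩ := hM
  obtain ⟨⟨d, rfl⟩, -⟩ := hN
  rw [Matrix.smul_mul, Matrix.mul_smul, weyl_comm, Matrix.smul_mul, Matrix.mul_smul]
  simp only [smul_smul]
  congr 1
  ring

/-- The clock operator of the qudit `t`. -/
def clock (D : ℕ) [Fact D.Prime] (t : Q) : Op (Cfg D Q) := weyl (0, Pi.single t 1)

/-- The raising operator of the qudit `t`. -/
def raise (D : ℕ) [Fact D.Prime] (t : Q) : Op (Cfg D Q) := weyl (-Pi.single t 1, 0)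

theorem mul_eq_mul_clock {α : Type} [Fintype α] {M : Op α} {E : Matrix α (Cfg D Q) ℂ} {t : Q}
    (h : ∀ b, M *ᵥ E.col b = chi D (b t) • E.col b) : M * E = E * clock D t := by
  ext i b
  have h1 : (M * E) i b = (M *ᵥ E.col b) i := rfl
  rw [h1, h, Matrix.mul_apply, Finset.sum_eq_single b]
  · simp [clock, weyl_apply, mul_comm]
  · intro c _ hc
    simp [clock, weyl_apply, Ne.symm hc]
  · simp

/-- The minus sign in `raise` is needed because `weyl u` sends `|j⟩` to a multiple of `|j - u.1⟩`.
-/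
theorem mul_eq_mul_raise {α : Type} [Fintype α] {M : Op α} {E : Matrix α (Cfg D Q) ℂ} {t : Q}
    (h : ∀ b, M *ᵥ E.col b = E.col (b + Pi.single t 1)) : M * E = E * raise D t := by
  ext i b
  have h1 : (M * E) i b = (M *ᵥ E.col b) i := rfl
  rw [h1, h, Matrix.mul_apply, Finset.sum_eq_single (b + Pi.single t 1)]
  · simp [raise, weyl_apply]
  · intro c _ hc
    have : ¬ b = c + -Pi.single t 1 := fun h => hc (by rw [h, neg_add_cancel_right])
    simp [raise, weyl_apply, this]
  · simp

theorem clock_conjTranspose (t : Q) :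
    (clock D t)ᴴ = weyl (0, -Pi.single t 1) := by
  ext i j
  by_cases h : i = j
  · subst h
    simp [clock, weyl_apply, star_chi]
  · simp [clock, weyl_apply, h, Ne.symm h]

theorem clock_mul_conjTranspose (t : Q) : (clock D t) * (clock D t)ᴴ = 1 :=
  weyl_mul_conjTranspose_self _

/-- Normalized Weyl operators along a partial symplectic basis are simultaneously unitarily
equivalent to clock and raising operators. -/
theorem exists_partial_weyl_frame {I J K : Type} [Fintype I] [DecidableEq I] [Fintype J]
    [DecidableEq J] [Fintype K] [DecidableEq K] {r : I → Phase D Q} {z x : J → Phase D Q}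
    {w : K → Phase D Q} (h : IsSympFam (symp D Q) z x)
    (hrw : LinearIndependent (ZMod D) (Sum.elim r w))
    (hyy : ∀ s t, symp D Q (Sum.elim r w s) (Sum.elim r w t) = 0)
    (hyz : ∀ s t, symp D Q (Sum.elim r w s) (z t) = 0)
    (hyx : ∀ s t, symp D Q (Sum.elim r w s) (x t) = 0)
    {R : I → Op (Cfg D Q)} {Z X : J → Op (Cfg D Q)} {W : K → Op (Cfg D Q)}
    (hR : ∀ i, IsNormWeyl (r i) (R i)) (hZ : ∀ i, IsNormWeyl (z i) (Z i))
    (hX : ∀ i, IsNormWeyl (x i) (X i)) (hW : ∀ i, IsNormWeyl (w i) (W i)) :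
    ∃ p : ℕ, Fintype.card Q = Fintype.card (I ⊕ Fin p ⊕ J ⊕ K) ∧
      ∃ E : Matrix (Cfg D Q) (Cfg D (I ⊕ Fin p ⊕ J ⊕ K)) ℂ, Eᴴ * E = 1 ∧ E * Eᴴ = 1 ∧
        (∀ i, R i * E = E * clock D (.inl i)) ∧
        (∀ i, Z i * E = E * clock D (.inr (.inr (.inl i)))) ∧
        (∀ i, X i * E = E * raise D (.inr (.inr (.inl i)))) ∧
        (∀ i, W i * E = E * raise D (.inr (.inr (.inr i)))) := by
  obtain ⟨p, z', x', hzx, hdim, hr', hz', hx', hw'⟩ :=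
    exists_symplectic_basis symp_isAlt symp_nondegenerate h hrw hyy hyz hyx
  have hcard : Fintype.card Q = Fintype.card (I ⊕ Fin p ⊕ J ⊕ K) := by
    simp only [Module.finrank_prod, Module.finrank_fintype_fun_eq_card] at hdim
    omega
  -- The given operators are used at the prescribed basis vectors and arbitrary normalized ones
  -- elsewhere; the equations record this through `choose`.
  have hM : ∀ t, ∃ M, IsNormWeyl (z' t) M ∧ (∀ i, t = .inl i → M = R i) ∧
      (∀ i, t = .inr (.inr (.inl i)) → M = Z i) := by
    rintro (i | i | i | i)
    · exact ⟨R i, hr' i ▸ hR i, by simp, by simp⟩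
    · obtain ⟨M, hM⟩ := exists_isNormWeyl (z' (.inr (.inl i)))
      exact ⟨M, hM, by simp, by simp⟩
    · exact ⟨Z i, hz' i ▸ hZ i, by simp, by simp⟩
    · obtain ⟨M, hM⟩ := exists_isNormWeyl (z' (.inr (.inr (.inr i))))
      exact ⟨M, hM, by simp, by simp⟩
  have hN : ∀ t, ∃ N, IsNormWeyl (x' t) N ∧ (∀ i, t = .inr (.inr (.inl i)) → N = X i) ∧
      (∀ i, t = .inr (.inr (.inr i)) → N = W i) := by
    rintro (i | i | i | i)
    · obtain ⟨M, hM⟩ := exists_isNormWeyl (x' (.inl i))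
      exact ⟨M, hM, by simp, by simp⟩
    · obtain ⟨M, hM⟩ := exists_isNormWeyl (x' (.inr (.inl i)))
      exact ⟨M, hM, by simp, by simp⟩
    · exact ⟨X i, hx' i ▸ hX i, by simp, by simp⟩
    · exact ⟨W i, hw' i ▸ hW i, by simp, by simp⟩
  choose M hM hMR hMZ using hM
  choose N hN hNX hNW using hN
  obtain ⟨E, hE, hE', hME, hNE⟩ := exists_weyl_frame hcard.symm (fun t => (hM t).2)
    (fun t => (hN t).2) (fun t => (hM t).conjTranspose_mul_self)
    (fun t => (hN t).conjTranspose_mul_self)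
    (fun s t => by rw [(hM s).comm (hM t), hzx.zz, AddChar.map_zero_eq_one, one_smul])
    (fun s t => by rw [(hN s).comm (hN t), hzx.xx, AddChar.map_zero_eq_one, one_smul])
    (fun s t => by rw [(hM s).comm (hN t), hzx.zx])
  refine ⟨p, hcard, E, hE, hE', fun i => ?_, fun i => ?_, fun i => ?_, fun i => ?_⟩
  · rw [← hMR _ i rfl]
    exact mul_eq_mul_clock (hME _)
  · rw [← hMZ _ i rfl]
    exact mul_eq_mul_clock (hME _)
  · rw [← hNX _ i rfl]
    exact mul_eq_mul_raise (hNE _)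
  · rw [← hNW _ i rfl]
    exact mul_eq_mul_raise (hNE _)

end NormWeyl

/-! ### Codes on a bipartite system -/

section Bipartite

variable {D : ℕ} [Fact D.Prime] {P Q : Type} [Fintype P] [DecidableEq P] [Fintype Q]
  [DecidableEq Q]

/-- The Weyl operators of the bipartite system. -/
def weyl₂ (l : Phase D P × Phase D Q) : Op (Cfg D P × Cfg D Q) := weyl l.1 ⊗ₖ weyl l.2

theorem weyl₂_mul (l m : Phase D P × Phase D Q) :
    weyl₂ l * weyl₂ m = chi D (-(l.1.2 ⬝ᵥ m.1.1) + -(l.2.2 ⬝ᵥ m.2.1)) • weyl₂ (l + m) := by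
  rw [weyl₂, weyl₂, ← Matrix.mul_kronecker_mul, weyl_mul_weyl, weyl_mul_weyl,
    Matrix.smul_kronecker, Matrix.kronecker_smul, smul_smul, AddChar.map_add_eq_mul]
  rfl

theorem weyl₂_comm (l m : Phase D P × Phase D Q) :
    weyl₂ l * weyl₂ m =
      chi D (symp D P l.1 m.1 + symp D Q l.2 m.2) • (weyl₂ m * weyl₂ l) := by
  rw [weyl₂, weyl₂, ← Matrix.mul_kronecker_mul, weyl_comm l.1, weyl_comm l.2,
    Matrix.smul_kronecker, Matrix.kronecker_smul, smul_smul, AddChar.map_add_eq_mul,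
    Matrix.mul_kronecker_mul]

theorem weyl₂_mulVec (u : Phase D P) (v : Phase D Q) (φ : Cfg D P × Cfg D Q → ℂ) (b : Cfg D P)
    (c : Cfg D Q) : ((weyl u ⊗ₖ weyl v) *ᵥ φ) (b, c) =
      chi D (u.2 ⬝ᵥ (b + u.1)) * chi D (v.2 ⬝ᵥ (c + v.1)) * φ (b + u.1, c + v.1) := by
  rw [Matrix.mulVec, dotProduct, Finset.sum_eq_single (b + u.1, c + v.1)]
  · simp [Matrix.kroneckerMap_apply, weyl_apply]
  · rintro ⟨b', c'⟩ _ h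
    rw [Matrix.kroneckerMap_apply, weyl_apply, weyl_apply]
    by_cases h1 : b' = b + u.1
    · have h2 : c' ≠ c + v.1 := fun h2 => h (by rw [h1, h2])
      simp [h2]
    · simp [h1]
  · simp

/-- The phase space points some multiple of whose Weyl operator fixes all kets in `S`. -/
def stab (S : Set (Cfg D P × Cfg D Q → ℂ)) : Submodule (ZMod D) (Phase D P × Phase D Q) :=
  let A : AddSubmonoid (Phase D P × Phase D Q) :=
    { carrier := {l | ∃ c : ℂ, ∀ φ ∈ S, (c • weyl₂ l) *ᵥ φ = φ}
      zero_mem' := ⟨1, fun φ _ => by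
        rw [weyl₂, Prod.fst_zero, Prod.snd_zero, weyl_zero, weyl_zero, Matrix.one_kronecker_one,
          one_smul, Matrix.one_mulVec]⟩
      add_mem' := by
        rintro l m ⟨c, hc⟩ ⟨d, hd⟩
        refine ⟨c * d * chi D (-(l.1.2 ⬝ᵥ m.1.1) + -(l.2.2 ⬝ᵥ m.2.1)), fun φ hφ => ?_⟩
        rw [mul_smul, ← weyl₂_mul]
        conv_rhs => rw [← hc φ hφ, ← hd φ hφ, Matrix.mulVec_mulVec, Matrix.smul_mul,
          Matrix.mul_smul, smul_smul] }
  { A with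
    smul_mem' := fun a l hl => by
      -- Scalars of `ZMod D` act as natural multiples, so closure under addition suffices.
      rw [← ZMod.natCast_zmod_val a, Nat.cast_smul_eq_nsmul]
      exact A.nsmul_mem hl _ }

/-- Two operators with a common nonzero fixed ket commute on that ket, so their commutation phase is
1. -/
theorem stab_isotropic {S : Set (Cfg D P × Cfg D Q → ℂ)} {φ : Cfg D P × Cfg D Q → ℂ}
    (hφS : φ ∈ S) (hφ : φ ≠ 0) {l m : Phase D P × Phase D Q} (hl : l ∈ stab S)
    (hm : m ∈ stab S) : symp D P l.1 m.1 + symp D Q l.2 m.2 = 0 := by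
  obtain ⟨c, hc⟩ := hl
  obtain ⟨d, hd⟩ := hm
  have h1 : (c • weyl₂ l) *ᵥ ((d • weyl₂ m) *ᵥ φ) = φ := by rw [hd φ hφS, hc φ hφS]
  have h2 : (d • weyl₂ m) *ᵥ ((c • weyl₂ l) *ᵥ φ) = φ := by rw [hc φ hφS, hd φ hφS]
  rw [Matrix.mulVec_mulVec, Matrix.smul_mul, Matrix.mul_smul] at h1 h2
  rw [weyl₂_comm, smul_comm d, smul_comm c, smul_comm c, smul_comm d, Matrix.smul_mulVec,
    smul_comm c, h2] at h1
  rw [← chi_eq_one_iff]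
  by_contra h
  have h3 : (chi D (symp D P l.1 m.1 + symp D Q l.2 m.2) - 1) • φ = 0 := by
    rw [sub_smul, h1, one_smul, sub_self]
  exact (smul_ne_zero (sub_ne_zero.mpr h) hφ) h3

theorem kronecker_pow {α β : Type} [Fintype α] [DecidableEq α] [Fintype β] [DecidableEq β]
    (M : Op α) (N : Op β) (m : ℕ) : (M ⊗ₖ N) ^ m = (M ^ m) ⊗ₖ (N ^ m) := by
  induction m with
  | zero => simp
  | succ m ih => rw [pow_succ, ih, ← Matrix.mul_kronecker_mul, pow_succ, pow_succ]

/-- The `D`-th power is a scalar, and it fixes the nonzero ket `φ`. -/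
theorem smul_weyl₂_pow_eq_one {φ : Cfg D P × Cfg D Q → ℂ} (hφ : φ ≠ 0) {c : ℂ}
    {l : Phase D P × Phase D Q} (h : (c • weyl₂ l) *ᵥ φ = φ) : (c • weyl₂ l) ^ D = 1 := by
  have h1 : ∀ m : ℕ, ((c • weyl₂ l) ^ m) *ᵥ φ = φ := by
    intro m
    induction m with
    | zero => rw [pow_zero, Matrix.one_mulVec]
    | succ m ih => rw [pow_succ, ← Matrix.mulVec_mulVec, h, ih]
  obtain ⟨d, -, hd⟩ := exists_weyl_pow_self l.1
  obtain ⟨e, -, he⟩ := exists_weyl_pow_self l.2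
  have h2 : (c • weyl₂ l) ^ D = (c ^ D * (e * d)) • (1 : Op (Cfg D P × Cfg D Q)) := by
    rw [smul_pow, weyl₂, kronecker_pow, hd, he, Matrix.smul_kronecker, Matrix.kronecker_smul,
      Matrix.one_kronecker_one, smul_smul, smul_smul, mul_assoc, mul_comm d e]
  have h3 := h1 D
  rw [h2, Matrix.smul_mulVec, Matrix.one_mulVec] at h3
  have h4 : c ^ D * (e * d) = 1 := by
    by_contra h
    have : (c ^ D * (e * d) - 1) • φ = 0 := by rw [sub_smul, h3, one_smul, sub_self]
    exact (smul_ne_zero (sub_ne_zero.mpr h) hφ) this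
  rw [h2, h4, one_smul]

theorem IsNormWeyl.exists_smul_eq {u : Phase D Q} {M : Op (Cfg D Q)} (h : IsNormWeyl u M) :
    ∃ c : ℂ, c ≠ 0 ∧ M = c • weyl u := by
  obtain ⟨⟨c, rfl⟩, h1⟩ := h
  refine ⟨c, ?_, rfl⟩
  rintro rfl
  rw [zero_smul, zero_pow (NeZero.ne D)] at h1
  exact zero_ne_one h1

/-- The normalization on the first side is free; the second factor absorbs the remaining phase, and
inherits order dividing `D` from the product. -/
theorem exists_isNormWeyl_right {S : Set (Cfg D P × Cfg D Q → ℂ)} {φ : Cfg D P × Cfg D Q → ℂ}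
    (hφS : φ ∈ S) (hφ : φ ≠ 0) {l : Phase D P × Phase D Q} (hl : l ∈ stab S)
    {M : Op (Cfg D P)} (hM : IsNormWeyl l.1 M) :
    ∃ N, IsNormWeyl l.2 N ∧ ∀ φ ∈ S, (M ⊗ₖ N) *ᵥ φ = φ := by
  obtain ⟨c, hc⟩ := hl
  obtain ⟨d, hd, hMd⟩ := hM.exists_smul_eq
  have hMN : M ⊗ₖ ((c / d) • weyl l.2) = c • weyl₂ l := by
    rw [hMd, Matrix.smul_kronecker, Matrix.kronecker_smul, smul_smul, mul_div_cancel₀ _ hd, weyl₂]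
  refine ⟨(c / d) • weyl l.2, ⟨⟨_, rfl⟩, ?_⟩, fun φ h => by rw [hMN, hc φ h]⟩
  have h1 := smul_weyl₂_pow_eq_one hφ (hc φ hφS)
  rw [← hMN, kronecker_pow, hM.2] at h1
  ext i j
  have h2 := congrFun (congrFun h1 (0, i)) (0, j)
  simpa [Matrix.kroneckerMap_apply, Matrix.one_apply] using h2

theorem exists_isNormWeyl_left {S : Set (Cfg D P × Cfg D Q → ℂ)} {φ : Cfg D P × Cfg D Q → ℂ}
    (hφS : φ ∈ S) (hφ : φ ≠ 0) {l : Phase D P × Phase D Q} (hl : l ∈ stab S)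
    {N : Op (Cfg D Q)} (hN : IsNormWeyl l.2 N) :
    ∃ M, IsNormWeyl l.1 M ∧ ∀ φ ∈ S, (M ⊗ₖ N) *ᵥ φ = φ := by
  obtain ⟨c, hc⟩ := hl
  obtain ⟨d, hd, hNd⟩ := hN.exists_smul_eq
  have hMN : ((c / d) • weyl l.1) ⊗ₖ N = c • weyl₂ l := by
    rw [hNd, Matrix.smul_kronecker, Matrix.kronecker_smul, smul_smul, div_mul_cancel₀ _ hd, weyl₂]
  refine ⟨(c / d) • weyl l.1, ⟨⟨_, rfl⟩, ?_⟩, fun φ h => by rw [hMN, hc φ h]⟩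
  have h1 := smul_weyl₂_pow_eq_one hφ (hc φ hφS)
  rw [← hMN, kronecker_pow, hN.2] at h1
  ext i j
  have h2 := congrFun (congrFun h1 (i, 0)) (j, 0)
  simpa [Matrix.kroneckerMap_apply, Matrix.one_apply] using h2

end Bipartite

/-! ### The standard form of a bipartite stabilizer code -/

section NormalForm

open Mult

variable {D : ℕ} [Fact D.Prime]

/-- The kets `φ` fixed by the stabilizer generators of the tensor product code described by `m`. -/
structure IsStandardKet {m : Mult} (φ : Cfg D m.QB × Cfg D m.QC → ℂ) : Prop where
  abc : ∀ i b c, φ (b, c) ≠ 0 → bABC b i = cABC c i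
  bc : ∀ i b c, φ (b, c) ≠ 0 → bBC b i = cBC c i
  shift_bc : ∀ i b c, φ (b - Pi.single (.inr (.inr (.inl i))) 1,
    c - Pi.single (.inr (.inr (.inl i))) 1) = φ (b, c)
  shift_b : ∀ i b c, φ (b - Pi.single (.inr (.inr (.inr i))) 1, c) = φ (b, c)
  shift_c : ∀ i b c, φ (b, c - Pi.single (.inr (.inr (.inr i))) 1) = φ (b, c)

theorem kronecker_mulVec_eq_iff {α β α' β' : Type} [Fintype α] [Fintype β] [Fintype α']
    [DecidableEq α'] [Fintype β'] [DecidableEq β'] {M : Op α} {N : Op β} {E : Matrix α α' ℂ}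
    {E' : Matrix β β' ℂ} {A : Op α'} {A' : Op β'} (hE : Eᴴ * E = 1) (hE' : E'ᴴ * E' = 1)
    (h : M * E = E * A) (h' : N * E' = E' * A') (φ : α' × β' → ℂ) :
    (M ⊗ₖ N) *ᵥ ((E ⊗ₖ E') *ᵥ φ) = (E ⊗ₖ E') *ᵥ φ ↔ (A ⊗ₖ A') *ᵥ φ = φ := by
  rw [Matrix.mulVec_mulVec, ← Matrix.mul_kronecker_mul, h, h', Matrix.mul_kronecker_mul,
    ← Matrix.mulVec_mulVec]
  refine ⟨fun heq => ?_, fun heq => by rw [heq]⟩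
  have := congrArg (fun ψ => (E ⊗ₖ E')ᴴ *ᵥ ψ) heq
  simpa only [Matrix.mulVec_mulVec, Matrix.conjTranspose_kronecker, ← Matrix.mul_assoc,
    ← Matrix.mul_kronecker_mul, hE, hE', Matrix.one_kronecker_one, Matrix.one_mulVec,
    Matrix.one_mul] using this

theorem clock_kronecker_fixed_iff {P Q : Type} [Fintype P] [DecidableEq P] [Fintype Q]
    [DecidableEq Q] (s : P) (t : Q) (φ : Cfg D P × Cfg D Q → ℂ) :
    (clock D s ⊗ₖ (clock D t)ᴴ) *ᵥ φ = φ ↔ ∀ b c, φ (b, c) ≠ 0 → b s = c t := by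
  rw [clock_conjTranspose, clock, funext_iff, Prod.forall]
  refine forall_congr' fun b => forall_congr' fun c => ?_
  rw [weyl₂_mulVec]
  simp only [add_zero, ← AddChar.map_add_eq_mul, neg_dotProduct, single_dotProduct, one_mul]
  by_cases h : φ (b, c) = 0
  · simp [h]
  · rw [mul_eq_right₀ h, chi_eq_one_iff, ← sub_eq_add_neg, sub_eq_zero]
    simp [h]

theorem raise_kronecker_fixed_iff {P Q : Type} [Fintype P] [DecidableEq P] [Fintype Q]
    [DecidableEq Q] (s : P) (t : Q) (φ : Cfg D P × Cfg D Q → ℂ) :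
    (raise D s ⊗ₖ raise D t) *ᵥ φ = φ ↔
      ∀ b c, φ (b - Pi.single s 1, c - Pi.single t 1) = φ (b, c) := by
  rw [raise, raise, funext_iff, Prod.forall]
  simp [weyl₂_mulVec, sub_eq_add_neg]

theorem raise_kronecker_one_fixed_iff {P Q : Type} [Fintype P] [DecidableEq P] [Fintype Q]
    [DecidableEq Q] (s : P) (φ : Cfg D P × Cfg D Q → ℂ) :
    (raise D s ⊗ₖ (1 : Op (Cfg D Q))) *ᵥ φ = φ ↔ ∀ b c, φ (b - Pi.single s 1, c) = φ (b, c) := by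
  rw [raise, ← weyl_zero, funext_iff, Prod.forall]
  simp [weyl₂_mulVec, sub_eq_add_neg]

theorem one_kronecker_raise_fixed_iff {P Q : Type} [Fintype P] [DecidableEq P] [Fintype Q]
    [DecidableEq Q] (t : Q) (φ : Cfg D P × Cfg D Q → ℂ) :
    ((1 : Op (Cfg D P)) ⊗ₖ raise D t) *ᵥ φ = φ ↔ ∀ b c, φ (b, c - Pi.single t 1) = φ (b, c) := by
  rw [raise, ← weyl_zero, funext_iff, Prod.forall]
  simp [weyl₂_mulVec, sub_eq_add_neg]

variable {P Q : Type} [Fintype P] [DecidableEq P] [Fintype Q] [DecidableEq Q]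

/-- A space of kets determined by its stabilizer is, up to local unitaries, a tensor product of
elementary codes. -/
theorem exists_standard_form {S : Set (Cfg D P × Cfg D Q → ℂ)} {φ₀ : Cfg D P × Cfg D Q → ℂ}
    (hφ₀S : φ₀ ∈ S) (hφ₀ : φ₀ ≠ 0)
    (hS : ∀ ψ, (∀ (c : ℂ) l, (∀ φ ∈ S, (c • weyl₂ l) *ᵥ φ = φ) → (c • weyl₂ l) *ᵥ ψ = ψ) →
      ψ ∈ S) :
    ∃ m : Mult, Fintype.card P = Fintype.card m.QB ∧ Fintype.card Q = Fintype.card m.QC ∧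
      ∃ (EB : Matrix (Cfg D P) (Cfg D m.QB) ℂ) (EC : Matrix (Cfg D Q) (Cfg D m.QC) ℂ),
        EBᴴ * EB = 1 ∧ EB * EBᴴ = 1 ∧ ECᴴ * EC = 1 ∧ EC * ECᴴ = 1 ∧
        ∀ φ, (EB ⊗ₖ EC) *ᵥ φ ∈ S ↔ IsStandardKet φ := by
  have hiso : ∀ l ∈ stab S, ∀ l' ∈ stab S, symp D P l.1 l'.1 + symp D Q l.2 l'.2 = 0 :=
    fun l hl l' hl' => stab_isotropic hφ₀S hφ₀ hl hl'
  obtain ⟨nI, nJ, nK, nK', r, z, x, w, w', hr, hz, hx, hw, hw', hgen, hzx, hrad, hli, hli'⟩ :=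
    exists_isotropic_normal_form symp_isAlt (stab S) hiso
  -- Isotropy makes the two local forms opposite on the stabilizer. Negating `z` on the second side
  -- restores the pairing, so these generators become `clock ⊗ clockᴴ` and `raise ⊗ raise`.
  have hzx' : IsSympFam (symp D Q) (fun i => -(z i).2) (fun i => (x i).2) := by
    have h1 : ∀ l ∈ stab S, ∀ l' ∈ stab S, symp D Q l.2 l'.2 = -symp D P l.1 l'.1 :=
      fun l hl l' hl' => (neg_eq_of_add_eq_zero_right (hiso l hl l' hl')).symm
    refine ⟨fun s t => ?_, fun s t => ?_, fun s t => ?_⟩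
    · simp [h1 _ (hz s) _ (hz t), hzx.zz s t]
    · simp [h1 _ (hx s) _ (hx t), hzx.xx s t]
    · simp [h1 _ (hz s) _ (hx t), hzx.zx s t]
  have horth : ∀ s, ∀ l ∈ stab S, symp D P (Sum.elim (fun i => (r i).1) w s) l.1 = 0 := by
    rintro (s | s) l hl
    · exact hrad s l hl
    · simpa using hiso _ (hw s) l hl
  have horth' : ∀ s, ∀ l ∈ stab S, symp D Q (Sum.elim (fun i => -(r i).2) w' s) l.2 = 0 := by
    rintro (s | s) l hl
    · have := hiso _ (hr s) l hl
      rw [hrad s l hl, zero_add] at this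
      simpa using this
    · simpa using hiso _ (hw' s) l hl
  have hliC : LinearIndependent (ZMod D) (Sum.elim (fun i => -(r i).2) w') := by
    have := hli'.units_smul (Sum.elim (fun _ => -1) (fun _ => 1))
    have heq : Sum.elim (fun i => -(r i).2) w' = (Sum.elim (fun _ => -1) (fun _ => 1) :
        Fin nI ⊕ Fin nK' → (ZMod D)ˣ) • Sum.elim (fun i => (r i).2) w' := by
      ext1 (i | i)
      · simp [Units.smul_def]
      · exact (one_smul (ZMod D)ˣ _).symm
    rw [heq]
    exact this
  have hRB := fun i => exists_isNormWeyl (r i).1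
  choose RB hRB using hRB
  have hRC := fun i => exists_isNormWeyl_right hφ₀S hφ₀ (hr i) (hRB i)
  choose RC hRC hRBC using hRC
  have hZB := fun i => exists_isNormWeyl (z i).1
  choose ZB hZB using hZB
  have hZC := fun i => exists_isNormWeyl_right hφ₀S hφ₀ (hz i) (hZB i)
  choose ZC hZC hZBC using hZC
  have hXB := fun i => exists_isNormWeyl (x i).1
  choose XB hXB using hXB
  have hXC := fun i => exists_isNormWeyl_right hφ₀S hφ₀ (hx i) (hXB i)
  choose XC hXC hXBC using hXC
  have hWB := fun i => exists_isNormWeyl_left hφ₀S hφ₀ (hw i) isNormWeyl_zero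
  choose WB hWB hWBS using hWB
  have hWC := fun i => exists_isNormWeyl_right hφ₀S hφ₀ (hw' i) isNormWeyl_zero
  choose WC hWC hWCS using hWC
  obtain ⟨p, hcardB, EB, hEB, hEB', hRE, hZE, hXE, hWE⟩ := exists_partial_weyl_frame hzx hli
    (by
      rintro s (t | t)
      · exact horth s _ (hr t)
      · exact horth s _ (hw t))
    (fun s t => horth s _ (hz t)) (fun s t => horth s _ (hx t)) hRB hZB hXB hWB
  obtain ⟨p', hcardC, EC, hEC, hEC', hRE', hZE', hXE', hWE'⟩ := exists_partial_weyl_frame hzx' hliC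
    (by
      rintro s (t | t)
      · simpa using horth' s _ (hr t)
      · exact horth' s _ (hw' t))
    (fun s t => by simpa using horth' s _ (hz t)) (fun s t => horth' s _ (hx t))
    (fun i => (hRC i).conjTranspose) (fun i => (hZC i).conjTranspose) hXC hWC
  have hadj : ∀ {v : Phase D Q} {N : Op (Cfg D Q)}
      {t : Fin nI ⊕ Fin p' ⊕ Fin nJ ⊕ Fin nK'}, IsNormWeyl v N →
      Nᴴ * EC = EC * clock D t → N * EC = EC * (clock D t)ᴴ := by
    intro v N t hN h
    have h1 := congrArg (fun A => N * A * (clock D t)ᴴ) h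
    simp only [← Matrix.mul_assoc, hN.mul_conjTranspose_self, Matrix.one_mul] at h1
    rw [h1, Matrix.mul_assoc, clock_mul_conjTranspose, Matrix.mul_one]
  -- Two-sided radical elements count GHZ factors, hyperbolic pairs count EPR pairs, one-sided
  -- elements count `|+⟩` states, and the free directions `p`, `p'` count transfers to `B` and `C`.
  refine ⟨⟨nI, p, p', nJ, nK, nK'⟩, hcardB, hcardC, EB, EC, hEB, hEB', hEC, hEC', fun φ => ?_⟩
  have e1 := fun i => (kronecker_mulVec_eq_iff hEB hEC (hRE i) (hadj (hRC i) (hRE' i)) φ).trans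
    (clock_kronecker_fixed_iff _ _ φ)
  have e2 := fun i => (kronecker_mulVec_eq_iff hEB hEC (hZE i) (hadj (hZC i) (hZE' i)) φ).trans
    (clock_kronecker_fixed_iff _ _ φ)
  have e3 := fun i => (kronecker_mulVec_eq_iff hEB hEC (hXE i) (hXE' i) φ).trans
    (raise_kronecker_fixed_iff _ _ φ)
  have e4 := fun i => (kronecker_mulVec_eq_iff (N := 1) (A' := 1) hEB hEC (hWE i)
    (by rw [Matrix.one_mul, Matrix.mul_one]) φ).trans (raise_kronecker_one_fixed_iff _ φ)
  have e5 := fun i => (kronecker_mulVec_eq_iff (M := 1) (A := 1) hEB hEC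
    (by rw [Matrix.one_mul, Matrix.mul_one]) (hWE' i) φ).trans (one_kronecker_raise_fixed_iff _ φ)
  constructor
  · intro h
    exact ⟨fun i => (e1 i).mp (hRBC i _ h), fun i => (e2 i).mp (hZBC i _ h),
      fun i => (e3 i).mp (hXBC i _ h), fun i => (e4 i).mp (hWBS i _ h),
      fun i => (e5 i).mp (hWCS i _ h)⟩
  · rintro ⟨h1, h2, h3, h4, h5⟩
    set ψ := (EB ⊗ₖ EC) *ᵥ φ with hψ
    have hmem : ∀ {u v} {M : Op (Cfg D P)} {N : Op (Cfg D Q)}, IsNormWeyl u M → IsNormWeyl v N →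
        (∀ φ ∈ S, (M ⊗ₖ N) *ᵥ φ = φ) → (M ⊗ₖ N) *ᵥ ψ = ψ → (u, v) ∈ stab (insert ψ S) := by
      rintro u v M N ⟨⟨c, rfl⟩, -⟩ ⟨⟨d, rfl⟩, -⟩ h hψ
      refine ⟨d * c, ?_⟩
      rw [weyl₂, ← smul_smul, ← Matrix.smul_kronecker, ← Matrix.kronecker_smul]
      rintro φ (rfl | hφ)
      exacts [hψ, h φ hφ]
    -- Fixing the generators puts them in the stabilizer of the enlarged set, and that stabilizer is
    -- a submodule; so every phase space point of `stab S` comes along.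
    have hle : stab S ≤ stab (insert ψ S) := by
      apply hgen
      · exact fun i => hmem (hRB i) (hRC i) (hRBC i) ((e1 i).mpr (h1 i))
      · exact fun i => hmem (hZB i) (hZC i) (hZBC i) ((e2 i).mpr (h2 i))
      · exact fun i => hmem (hXB i) (hXC i) (hXBC i) ((e3 i).mpr (h3 i))
      · exact fun i => hmem (hWB i) isNormWeyl_zero (hWBS i) ((e4 i).mpr (h4 i))
      · exact fun i => hmem isNormWeyl_zero (hWC i) (hWCS i) ((e5 i).mpr (h5 i))
    refine hS ψ fun c l hc => ?_
    obtain ⟨d, hd⟩ := hle (⟨c, hc⟩ : l ∈ stab S)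
    -- The scalar attached to `l` cannot depend on the set, as both choices fix the nonzero ket
    -- `φ₀`.
    have hcd : c = d := by
      by_contra hne
      have h6 := hc φ₀ hφ₀S
      have h7 := hd φ₀ (Set.mem_insert_of_mem _ hφ₀S)
      have h8 : (c - d) • (weyl₂ l *ᵥ φ₀) = 0 := by
        rw [sub_smul, ← Matrix.smul_mulVec, ← Matrix.smul_mulVec, h6, h7, sub_self]
      rw [smul_eq_zero, or_iff_right (sub_ne_zero.mpr hne)] at h8
      rw [Matrix.smul_mulVec, h8, smul_zero] at h6
      exact hφ₀ h6.symm
    rw [hcd]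
    exact hd ψ (Set.mem_insert _ _)

end NormalForm

/-! ### The elementary isometry -/

section Isometry

open Mult

variable {D : ℕ} [Fact D.Prime]

theorem one_div_sqrt_mul_self : (1 / (Real.sqrt D : ℂ)) * (1 / (Real.sqrt D : ℂ)) = 1 / D := by
  rw [div_mul_div_comm, one_mul, ← Complex.ofReal_mul, Real.mul_self_sqrt (Nat.cast_nonneg D),
    Complex.ofReal_natCast]

theorem one_div_sqrt_ne_zero : (1 / (Real.sqrt D : ℂ)) ≠ 0 := by
  have : (0 : ℝ) < D := Nat.cast_pos.mpr (NeZero.pos D)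
  exact one_div_ne_zero (Complex.ofReal_ne_zero.mpr (Real.sqrt_pos.mpr this).ne')

theorem natCast_ne_zero_of_prime : (D : ℂ) ≠ 0 := Nat.cast_ne_zero.mpr (NeZero.ne D)

/-- The amplitude of the nonzero matrix elements of the elementary isometry. -/
def amplitude (D : ℕ) (m : Mult) : ℂ := (1 / (Real.sqrt D : ℂ)) ^ (m.mBC + m.mB + m.mC)

theorem star_amplitude (m : Mult) : star (amplitude D m) = amplitude D m := by
  simp [amplitude]

theorem amplitude_ne_zero (m : Mult) : amplitude D m ≠ 0 := pow_ne_zero _ one_div_sqrt_ne_zero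

theorem amplitude_mul_self (m : Mult) :
    amplitude D m * amplitude D m = (1 / (D : ℂ)) ^ (m.mBC + m.mB + m.mC) := by
  rw [amplitude, ← mul_pow, one_div_sqrt_mul_self]

theorem isometry_apply (m : Mult) (b : Cfg D m.QB) (c : Cfg D m.QC) (a : Cfg D m.QA) :
    m.isometry D (b, c) a = if cABC c = aABC a ∧ cAC c = aAC a ∧ bBC b = cBC c ∧
      bABC b = aABC a ∧ bAB b = aAB a then amplitude D m else 0 := by
  simp only [isometry, Matrix.of_apply, vGHZ, vEPR, ketEPR, ketPlus, Finset.prod_ite_zero,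
    Finset.mem_univ, true_implies, Finset.prod_const, Finset.card_univ, Fintype.card_fin,
    funext_iff, one_pow, forall_and, amplitude, pow_add]
  split_ifs <;> simp_all

theorem sum_cfg {I J K L : Type} [Fintype I] [DecidableEq I] [Fintype J] [DecidableEq J]
    [Fintype K] [DecidableEq K] [Fintype L] [DecidableEq L] (f : Cfg D (I ⊕ J ⊕ K ⊕ L) → ℂ) :
    ∑ c, f c = ∑ i, ∑ j, ∑ k, ∑ l, f (Sum.elim i (Sum.elim j (Sum.elim k l))) := by
  rw [← (Equiv.sumArrowEquivProdArrow I _ _).symm.sum_comp, Fintype.sum_prod_type]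
  refine Finset.sum_congr rfl fun i _ => ?_
  rw [← (Equiv.sumArrowEquivProdArrow J _ _).symm.sum_comp, Fintype.sum_prod_type]
  refine Finset.sum_congr rfl fun j _ => ?_
  rw [← (Equiv.sumArrowEquivProdArrow K _ _).symm.sum_comp, Fintype.sum_prod_type]
  rfl

theorem isometry_apply_sumElim_right (m : Mult) (b : Cfg D m.QB) (a : Cfg D m.QA)
    (i : Cfg D (Fin m.mABC)) (j : Cfg D (Fin m.mAC)) (k : Cfg D (Fin m.mBC))
    (l : Cfg D (Fin m.mC)) : m.isometry D (b, Sum.elim i (Sum.elim j (Sum.elim k l))) a =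
      if i = aABC a ∧ j = aAC a ∧ bBC b = k ∧ bABC b = aABC a ∧ bAB b = aAB a
        then amplitude D m else 0 :=
  isometry_apply _ _ _ _

/-! ### Matrix elements of the elementary channels -/

theorem elem_decohering (a a' b b' : ZMod D) :
    elem (decohering D) a a' b b' = if (a = b ∧ a' = b') ∧ b = b' then 1 else 0 := by
  simp only [elem, decohering, LinearMap.coe_mk, AddHom.coe_mk, Matrix.sum_apply,
    Matrix.mul_apply, Matrix.single_apply]
  rw [Finset.sum_eq_single b]
  · rw [Finset.sum_eq_single b', Finset.sum_eq_single b]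
    · split_ifs <;> simp_all
    · intro x _ hx
      simp [Ne.symm hx]
    · simp
    · intro x _ hx
      rcases eq_or_ne b x with rfl | h
      · simp [Ne.symm hx, hx]
      · simp [h, hx]
    · simp
  · intro x _ hx
    simp [hx]
  · simp

theorem elem_perfect (a a' b b' : ZMod D) :
    elem (perfect D) a a' b b' = if a = b ∧ a' = b' then 1 else 0 := by
  simp [elem, perfect, Matrix.single_apply]

theorem elem_depolarizing {α β : Type} [Fintype α] [DecidableEq α] [Fintype β] [DecidableEq β]
    (a a' : α) (b b' : β) : elem (depolarizing α β) a a' b b' =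
      if a = a' ∧ b = b' then 1 / (Fintype.card β : ℂ) else 0 := by
  simp only [elem, depolarizing, LinearMap.coe_mk, AddHom.coe_mk, Matrix.smul_apply,
    Matrix.one_apply, smul_eq_mul]
  by_cases h : a = a'
  · subst h
    simp
  · simp [h, Matrix.trace_single_eq_of_ne a a' (1 : ℂ) h]

theorem prod_elem_decohering {n : ℕ} (a a' b b' : Cfg D (Fin n)) :
    ∏ i, elem (decohering D) (a i) (a' i) (b i) (b' i) =
      if (a = b ∧ a' = b') ∧ b = b' then 1 else 0 := by
  simp only [elem_decohering, Finset.prod_ite_zero, Finset.mem_univ, true_implies, forall_and,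
    funext_iff, Finset.prod_const_one]

theorem prod_elem_perfect {n : ℕ} (a a' b b' : Cfg D (Fin n)) :
    ∏ i, elem (perfect D) (a i) (a' i) (b i) (b' i) = if a = b ∧ a' = b' then 1 else 0 := by
  simp only [elem_perfect, Finset.prod_ite_zero, Finset.mem_univ, true_implies, forall_and,
    funext_iff, Finset.prod_const_one]

theorem sum_isometry_mul_star_right (m : Mult) (b b' : Cfg D m.QB) (a a' : Cfg D m.QA) :
    ∑ c, m.isometry D (b, c) a * star (m.isometry D (b', c) a') =
      (∏ i, elem (decohering D) (aABC a i) (aABC a' i) (bABC b i) (bABC b' i)) *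
      (∏ i, elem (perfect D) (aAB a i) (aAB a' i) (bAB b i) (bAB b' i)) *
      elem (depolarizing (Cfg D (Fin m.mAC)) (Cfg D (Fin m.mBC)))
        (aAC a) (aAC a') (bBC b) (bBC b') *
      (∏ i, ketPlus D (bB b i) * star (ketPlus D (bB b' i))) := by
  have hlhs : ∑ c, m.isometry D (b, c) a * star (m.isometry D (b', c) a') =
      if ((aABC a = bABC b ∧ aABC a' = bABC b') ∧ bABC b = bABC b') ∧
        (aAB a = bAB b ∧ aAB a' = bAB b') ∧ aAC a = aAC a' ∧ bBC b = bBC b' then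
        (1 / (D : ℂ)) ^ m.mBC * (1 / (D : ℂ)) ^ m.mB else 0 := by
    rw [sum_cfg]
    simp only [isometry_apply_sumElim_right]
    rw [Fintype.sum_eq_single (aABC a), Fintype.sum_eq_single (aAC a),
      Fintype.sum_eq_single (bBC b)]
    · simp only [Finset.sum_const, Finset.card_univ, true_and,
        nsmul_eq_mul, Fintype.card_pi, ZMod.card, Finset.prod_const, Fintype.card_fin]
      -- The labels of the `|+⟩` qudits of `C` are summed freely, and their number cancels their
      -- share of the squared amplitude.
      have hD : ((D ^ m.mC : ℕ) : ℂ) * (amplitude D m * amplitude D m) =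
          (1 / (D : ℂ)) ^ m.mBC * (1 / (D : ℂ)) ^ m.mB := by
        have := natCast_ne_zero_of_prime (D := D)
        rw [amplitude_mul_self, pow_add, pow_add, Nat.cast_pow, mul_comm, mul_assoc, ← mul_pow,
          one_div_mul_cancel this, one_pow, mul_one]
      rw [apply_ite star, star_zero, star_amplitude, ite_zero_mul_ite_zero, mul_ite, mul_zero, hD]
      refine if_congr ?_ rfl rfl
      constructor
      · rintro ⟨⟨h1, h2⟩, h3, h4, h5, h6, h7⟩
        exact ⟨⟨⟨h1.symm, h6.symm⟩, by rw [h1, h6]; exact h3⟩, ⟨h2.symm, h7.symm⟩, h4, h5.symm⟩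
      · rintro ⟨⟨⟨h1, h2⟩, h3⟩, ⟨h4, h5⟩, h6, h7⟩
        exact ⟨⟨h1.symm, h4.symm⟩, by rw [h2, ← h3]; exact h1, h6, h7.symm, h2.symm, h5.symm⟩
    · intro x hx
      simp [Ne.symm hx]
    · intro x hx
      simp [hx]
    · intro x hx
      simp [hx]
  rw [hlhs]
  have hp : (∏ i, ketPlus D (bB b i) * star (ketPlus D (bB b' i))) = (1 / (D : ℂ)) ^ m.mB := by
    simp only [ketPlus]
    rw [Finset.prod_const, Finset.card_univ, Fintype.card_fin]
    congr 1
    rw [← one_div_sqrt_mul_self]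
    simp
  rw [hp, prod_elem_decohering, prod_elem_perfect, elem_depolarizing, ite_zero_mul_ite_zero, one_mul,
    ite_zero_mul_ite_zero, one_mul, ite_mul, zero_mul]
  refine if_congr (by simp only [and_assoc]) ?_ rfl
  simp only [Fintype.card_pi, ZMod.card, Finset.prod_const, Finset.card_univ, Fintype.card_fin,
    Nat.cast_pow, one_div, inv_pow]

theorem sum_isometry_mul_star_left (m : Mult) (c c' : Cfg D m.QC) (a a' : Cfg D m.QA) :
    ∑ b, m.isometry D (b, c) a * star (m.isometry D (b, c') a') =
      (∏ i, elem (decohering D) (aABC a i) (aABC a' i) (cABC c i) (cABC c' i)) *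
      (∏ i, elem (perfect D) (aAC a i) (aAC a' i) (cAC c i) (cAC c' i)) *
      elem (depolarizing (Cfg D (Fin m.mAB)) (Cfg D (Fin m.mBC)))
        (aAB a) (aAB a') (cBC c) (cBC c') *
      (∏ i, ketPlus D (cC c i) * star (ketPlus D (cC c' i))) := by
  -- Exchanging `B` and `C` turns the elementary isometry into the one with `mAB`, `mAC` and `mB`,
  -- `mC` swapped, so this is the previous computation.
  let m' : Mult := ⟨m.mABC, m.mAC, m.mAB, m.mBC, m.mC, m.mB⟩
  let s : Cfg D m.QA → Cfg D m'.QA := fun a =>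
    Sum.elim (aABC (m := m) a) (Sum.elim (aAC (m := m) a) (aAB (m := m) a))
  have h : ∀ b c a, m.isometry D (b, c) a = m'.isometry D (c, b) (s a) := by
    intro b c a
    rw [isometry_apply, isometry_apply]
    have hamp : amplitude D m' = amplitude D m := by
      rw [amplitude, amplitude]
      congr 1
      exact add_right_comm _ _ _
    rw [hamp]
    refine if_congr ?_ rfl rfl
    constructor
    · rintro ⟨h1, h2, h3, h4, h5⟩
      exact ⟨h4, h5, h3.symm, h1, h2⟩
    · rintro ⟨h1, h2, h3, h4, h5⟩
      exact ⟨h4, h5, h3.symm, h1, h2⟩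
  simp only [h]
  exact sum_isometry_mul_star_right m' c c' (s a) (s a')

/-- Obtained by tracing `B` out of the matrix elements left after tracing out `C`. -/
theorem isometry_conjTranspose_mul_self (m : Mult) : (m.isometry D)ᴴ * m.isometry D = 1 := by
  ext a a'
  have h1 : ((m.isometry D)ᴴ * m.isometry D) a a' =
      ∑ b, ∑ c, m.isometry D (b, c) a' * star (m.isometry D (b, c) a) := by
    rw [Matrix.mul_apply, Fintype.sum_prod_type]
    simp only [Matrix.conjTranspose_apply, mul_comm]
  have hD := natCast_ne_zero_of_prime (D := D)
  have hterm : ∀ i j k l, (∑ c, m.isometry D (Sum.elim i (Sum.elim j (Sum.elim k l)), c) a' *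
      star (m.isometry D (Sum.elim i (Sum.elim j (Sum.elim k l)), c) a)) =
      if (aABC a' = i ∧ aABC a = i) ∧ (aAB a' = j ∧ aAB a = j) ∧ aAC a' = aAC a then
        1 / (D : ℂ) ^ m.mBC * (1 / D) ^ m.mB else 0 := by
    intro i j k l
    rw [sum_isometry_mul_star_right, prod_elem_decohering, prod_elem_perfect, elem_depolarizing,
      ite_zero_mul_ite_zero, one_mul, ite_zero_mul_ite_zero, one_mul, ite_mul, zero_mul]
    refine if_congr ?_ ?_ rfl
    · change (((aABC a' = i ∧ aABC a = i) ∧ i = i) ∧ aAB a' = j ∧ aAB a = j) ∧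
        aAC a' = aAC a ∧ k = k ↔ _
      simp only [and_assoc, true_and, and_true]
    congr 1
    · simp
    · simp only [ketPlus]
      rw [Finset.prod_const, Finset.card_univ, Fintype.card_fin, ← one_div_sqrt_mul_self]
      simp
  rw [h1, sum_cfg]
  simp only [hterm]
  rw [Fintype.sum_eq_single (aABC a), Fintype.sum_eq_single (aAB a)]
  · simp only [Finset.sum_const, Finset.card_univ, nsmul_eq_mul, Fintype.card_pi, ZMod.card,
      Finset.prod_const, Fintype.card_fin, and_true]
    rw [Matrix.one_apply]
    have hiff : (aABC a' = aABC a ∧ aAB a' = aAB a ∧ aAC a' = aAC a) ↔ a = a' := by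
      constructor
      · rintro ⟨h1, h2, h3⟩
        funext q
        rcases q with q | q | q
        exacts [(congrFun h1 q).symm, (congrFun h2 q).symm, (congrFun h3 q).symm]
      · rintro rfl
        exact ⟨rfl, rfl, rfl⟩
    rw [if_congr hiff rfl rfl]
    split_ifs
    · push_cast
      rw [mul_left_comm ((D : ℂ) ^ m.mB), ← mul_pow, mul_one_div_cancel hD, one_pow, mul_one,
        mul_one_div_cancel (pow_ne_zero _ hD)]
    · simp
  · intro x hx
    simp [Ne.symm hx]
  · intro x hx
    simp [Ne.symm hx]

/-! ### Standard kets are the range of the elementary isometry -/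

theorem pi_zmod_induction {T : Type} [Fintype T] [DecidableEq T] {p : (T → ZMod D) → Prop}
    (zero : p 0) (add : ∀ b c, p b → p c → p (b + c)) (single : ∀ t, p (Pi.single t 1))
    (b : T → ZMod D) : p b := by
  rw [← Finset.univ_sum_single b]
  refine Finset.sum_induction _ p add zero fun t _ => ?_
  have h : ∀ n : ℕ, p (Pi.single t (n : ZMod D)) := by
    intro n
    induction n with
    | zero => simpa using zero
    | succ n ih =>
      rw [Nat.cast_succ, Pi.single_add]
      exact add _ _ ih (single t)
  simpa using h (b t).val

/-- Extension by zero from the last two groups of qudits. -/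
def padZero {I J K L : Type} (k : Cfg D K) (l : Cfg D L) : Cfg D (I ⊕ J ⊕ K ⊕ L) :=
  Sum.elim (0 : Cfg D I) (Sum.elim (0 : Cfg D J) (Sum.elim k l))

theorem padZero_add {I J K L : Type} (k k' : Cfg D K) (l l' : Cfg D L) :
    (padZero (k + k') (l + l') : Cfg D (I ⊕ J ⊕ K ⊕ L)) = padZero k l + padZero k' l' := by
  ext (q | q | q | q) <;> simp [padZero]

theorem padZero_zero {I J K L : Type} : (padZero 0 0 : Cfg D (I ⊕ J ⊕ K ⊕ L)) = 0 := by
  ext (q | q | q | q) <;> simp [padZero]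

theorem padZero_single_left {I J K L : Type} [DecidableEq I] [DecidableEq J] [DecidableEq K]
    [DecidableEq L] (i : K) : (padZero (Pi.single i 1) 0 : Cfg D (I ⊕ J ⊕ K ⊕ L)) =
      Pi.single (.inr (.inr (.inl i))) 1 := by
  ext (q | q | q | q) <;> simp [padZero, Pi.single_apply]

theorem padZero_single_right {I J K L : Type} [DecidableEq I] [DecidableEq J] [DecidableEq K]
    [DecidableEq L] (i : L) : (padZero 0 (Pi.single i 1) : Cfg D (I ⊕ J ⊕ K ⊕ L)) =
      Pi.single (.inr (.inr (.inr i))) 1 := by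
  ext (q | q | q | q) <;> simp [padZero, Pi.single_apply]

theorem IsStandardKet.shift {m : Mult} {φ : Cfg D m.QB × Cfg D m.QC → ℂ} (h : IsStandardKet φ)
    (t : Cfg D (Fin m.mBC)) (u : Cfg D (Fin m.mB)) (v : Cfg D (Fin m.mC)) (b : Cfg D m.QB)
    (c : Cfg D m.QC) : φ (b - padZero t u, c - padZero t v) = φ (b, c) := by
  have h1 : ∀ t : Cfg D (Fin m.mBC), ∀ b c, φ (b - padZero t 0, c - padZero t 0) = φ (b, c) := by
    refine pi_zmod_induction (fun b c => ?_) (fun s t hs ht b c => ?_) fun i b c => ?_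
    · rw [padZero_zero, padZero_zero, sub_zero, sub_zero]
    · rw [← add_zero (0 : Cfg D (Fin m.mB)), ← add_zero (0 : Cfg D (Fin m.mC)), padZero_add,
        padZero_add, ← sub_sub, ← sub_sub, ht, hs]
    · rw [padZero_single_left, padZero_single_left, h.shift_bc]
  have h2 : ∀ u : Cfg D (Fin m.mB), ∀ b c, φ (b - padZero 0 u, c) = φ (b, c) := by
    refine pi_zmod_induction (fun b c => ?_) (fun s t hs ht b c => ?_) fun i b c => ?_
    · rw [padZero_zero, sub_zero]
    · rw [← add_zero (0 : Cfg D (Fin m.mBC)), padZero_add, ← sub_sub, ht, hs]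
    · rw [padZero_single_right, h.shift_b]
  have h3 : ∀ v : Cfg D (Fin m.mC), ∀ b c, φ (b, c - padZero 0 v) = φ (b, c) := by
    refine pi_zmod_induction (fun b c => ?_) (fun s t hs ht b c => ?_) fun i b c => ?_
    · rw [padZero_zero, sub_zero]
    · rw [← add_zero (0 : Cfg D (Fin m.mBC)), padZero_add, ← sub_sub, ht, hs]
    · rw [padZero_single_right, h.shift_c]
  rw [← h1 t b c, ← h2 u (b - padZero t 0), ← h3 v _ (c - padZero t 0), sub_sub, sub_sub,
    ← padZero_add, ← padZero_add, add_zero, zero_add, zero_add]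

theorem isStandardKet_isometry_mulVec (m : Mult) (x : Cfg D m.QA → ℂ) :
    IsStandardKet (m.isometry D *ᵥ x) := by
  have hne : ∀ b c, (m.isometry D *ᵥ x) (b, c) ≠ 0 → bABC b = cABC c ∧ bBC b = cBC c := by
    intro b c h
    obtain ⟨a, -, ha⟩ := Finset.exists_ne_zero_of_sum_ne_zero h
    have h1 : m.isometry D (b, c) a ≠ 0 := left_ne_zero_of_mul ha
    rw [isometry_apply] at h1
    have h2 := (ite_ne_right_iff.mp h1).1
    exact ⟨h2.2.2.2.1.trans h2.1.symm, h2.2.2.1⟩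
  have heq : ∀ b c b' c', (∀ a, m.isometry D (b, c) a = m.isometry D (b', c') a) →
      (m.isometry D *ᵥ x) (b, c) = (m.isometry D *ᵥ x) (b', c') := fun b c b' c' h =>
    Finset.sum_congr rfl fun a _ => congrArg (· * x a) (h a)
  refine ⟨fun i b c h => congrFun (hne b c h).1 i, fun i b c h => congrFun (hne b c h).2 i,
    fun i b c => heq _ _ _ _ fun a => ?_, fun i b c => heq _ _ _ _ fun a => ?_,
    fun i b c => heq _ _ _ _ fun a => ?_⟩
  all_goals
    rw [isometry_apply, isometry_apply]
    refine if_congr ?_ rfl rfl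
    simp [funext_iff, Pi.single_apply]

theorem IsStandardKet.exists_isometry_mulVec {m : Mult} {φ : Cfg D m.QB × Cfg D m.QC → ℂ}
    (h : IsStandardKet φ) : ∃ x, m.isometry D *ᵥ x = φ := by
  let bRep : Cfg D m.QA → Cfg D m.QB := fun a =>
    Sum.elim (aABC a) (Sum.elim (aAB a) (Sum.elim (0 : Cfg D (Fin m.mBC)) (0 : Cfg D (Fin m.mB))))
  let cRep : Cfg D m.QA → Cfg D m.QC := fun a =>
    Sum.elim (aABC a) (Sum.elim (aAC a) (Sum.elim (0 : Cfg D (Fin m.mBC)) (0 : Cfg D (Fin m.mC))))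
  -- Shift invariance determines `φ` by its values where the EPR and `|+⟩` labels are 0; the
  -- diagonal constraints then index these values by `a`.
  refine ⟨fun a => (amplitude D m)⁻¹ * φ (bRep a, cRep a), ?_⟩
  ext ⟨b, c⟩
  rw [Matrix.mulVec, dotProduct]
  by_cases hbc : bABC b = cABC c ∧ bBC b = cBC c
  · rw [Fintype.sum_eq_single (Sum.elim (bABC b) (Sum.elim (bAB b) (cAC c)))]
    · rw [isometry_apply, if_pos ⟨hbc.1.symm, rfl, hbc.2, rfl, rfl⟩,
        mul_inv_cancel_left₀ (amplitude_ne_zero m), ← h.shift (bBC b) (bB b) (cC c) b c]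
      have hb : bRep (Sum.elim (bABC b) (Sum.elim (bAB b) (cAC c))) =
          b - padZero (bBC b) (bB b) := by
        ext (q | q | q | q) <;> simp [bRep, padZero]
      have hc : cRep (Sum.elim (bABC b) (Sum.elim (bAB b) (cAC c))) =
          c - padZero (bBC b) (cC c) := by
        rw [hbc.1, hbc.2]
        ext (q | q | q | q) <;> simp [cRep, padZero]
      rw [hb, hc]
    · intro a ha
      rw [isometry_apply, if_neg, zero_mul]
      rintro ⟨h1, h2, h3, h4, h5⟩
      apply ha
      rw [h4, h5, h2]
      ext (q | q | q) <;> rfl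
  · have h0 : φ (b, c) = 0 := by
      by_contra hne
      exact hbc ⟨funext fun i => h.abc i b c hne, funext fun i => h.bc i b c hne⟩
    rw [h0]
    refine Finset.sum_eq_zero fun a _ => ?_
    rw [isometry_apply, if_neg, zero_mul]
    rintro ⟨h1, h2, h3, h4, h5⟩
    exact hbc ⟨h4.trans h1.symm, h3⟩

end Isometry

/-! ### Channels and the final assembly -/

section Channels

/-- The isometry on the traced factor cancels inside the sum over its label, as its columns are
orthonormal. -/
theorem traceSnd_kronecker_conj {β γ β' γ' : Type} [Fintype β] [Fintype γ] [Fintype γ']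
    [DecidableEq γ] (U : Matrix β' β ℂ) {U' : Matrix γ' γ ℂ} (hU' : U'ᴴ * U' = 1)
    (M : Op (β × γ)) : traceSnd ((U ⊗ₖ U') * M * (U ⊗ₖ U')ᴴ) = U * traceSnd M * Uᴴ := by
  ext b b'
  have hU : ∀ y y', ∑ c, U' c y * star (U' c y') = if y' = y then 1 else 0 := by
    intro y y'
    have := congrFun (congrFun hU' y') y
    rw [Matrix.mul_apply, Matrix.one_apply] at this
    rw [← this]
    exact Finset.sum_congr rfl fun c _ => mul_comm _ _
  simp only [traceSnd, Matrix.of_apply, Matrix.mul_apply, Matrix.conjTranspose_apply,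
    Matrix.kroneckerMap_apply, Fintype.sum_prod_type, Finset.sum_mul, star_mul', Finset.mul_sum]
  rw [Finset.sum_comm]
  refine Finset.sum_congr rfl fun x' _ => ?_
  calc ∑ c, ∑ y', ∑ x, ∑ y, U b x * U' c y * M (x, y) (x', y') * (star (U b' x') * star (U' c y'))
      = ∑ y', ∑ x, ∑ y, U b x * M (x, y) (x', y') * star (U b' x') *
          ∑ c, U' c y * star (U' c y') := by
        rw [Finset.sum_comm]
        refine Finset.sum_congr rfl fun y' _ => ?_
        rw [Finset.sum_comm]
        refine Finset.sum_congr rfl fun x _ => ?_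
        rw [Finset.sum_comm]
        refine Finset.sum_congr rfl fun y _ => ?_
        rw [Finset.mul_sum]
        refine Finset.sum_congr rfl fun c _ => ?_
        ring
    _ = _ := by
        rw [Finset.sum_comm]
        refine Finset.sum_congr rfl fun x _ => ?_
        refine Finset.sum_congr rfl fun y _ => ?_
        simp only [hU, mul_ite, mul_one, mul_zero, Finset.sum_ite_eq, Finset.mem_univ, if_true]

theorem traceFst_eq_traceSnd_swap {β γ : Type} [Fintype β] (M : Op (β × γ)) :
    traceFst M = traceSnd (M.submatrix Prod.swap Prod.swap) := rfl

theorem traceFst_kronecker_conj {β γ β' γ' : Type} [Fintype β] [Fintype γ] [Fintype β']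
    [DecidableEq β] {U : Matrix β' β ℂ} (U' : Matrix γ' γ ℂ) (hU : Uᴴ * U = 1)
    (M : Op (β × γ)) : traceFst ((U ⊗ₖ U') * M * (U ⊗ₖ U')ᴴ) = U' * traceFst M * U'ᴴ := by
  rw [traceFst_eq_traceSnd_swap, traceFst_eq_traceSnd_swap, ← traceSnd_kronecker_conj U' hU]
  congr 1
  have h : (U' ⊗ₖ U) = (U ⊗ₖ U').submatrix Prod.swap Prod.swap := by
    ext ⟨i, j⟩ ⟨k, l⟩
    exact mul_comm _ _
  rw [h, Matrix.conjTranspose_submatrix]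
  exact (Matrix.submatrix_mul_equiv _ _ _ (Equiv.prodComm γ β) _).symm.trans
    (congrArg (· * _) (Matrix.submatrix_mul_equiv _ _ _ (Equiv.prodComm γ β) _).symm)

theorem traceSnd_submatrix {β γ β' γ' : Type} [Fintype γ] [Fintype γ'] (f : β' → β) (g : γ' ≃ γ)
    (M : Op (β × γ)) : traceSnd (M.submatrix (fun x => (f x.1, g x.2)) fun x => (f x.1, g x.2)) =
      (traceSnd M).submatrix f f := by
  ext b b'
  exact g.sum_comp fun c => M (f b, c) (f b', c)

theorem traceFst_submatrix {β γ β' γ' : Type} [Fintype β] [Fintype β'] (f : β' ≃ β) (g : γ' → γ)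
    (M : Op (β × γ)) : traceFst (M.submatrix (fun x => (f x.1, g x.2)) fun x => (f x.1, g x.2)) =
      (traceFst M).submatrix g g := by
  ext c c'
  exact f.sum_comp fun b => M (b, g c) (b, g c')

variable {D : ℕ} [Fact D.Prime]

theorem mul_mul_conjTranspose_apply {α κ : Type} [Fintype α] (G : Matrix κ α ℂ) (ρ : Op α)
    (x y : κ) : (G * ρ * Gᴴ) x y = ∑ a, ∑ a', ρ a a' * (G x a * star (G y a')) := by
  simp only [Matrix.mul_apply, Matrix.conjTranspose_apply, Finset.sum_mul]
  rw [Finset.sum_comm]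
  refine Finset.sum_congr rfl fun a _ => Finset.sum_congr rfl fun a' _ => ?_
  ring

theorem traceSnd_isometry_conj (m : Mult) (ρ : Op (Cfg D m.QA)) :
    traceSnd (m.isometry D * ρ * (m.isometry D)ᴴ) = m.prodChannelB D ρ := by
  ext b b'
  simp only [traceSnd, Mult.prodChannelB, Matrix.of_apply, mul_mul_conjTranspose_apply]
  rw [Finset.sum_comm]
  refine Finset.sum_congr rfl fun a _ => ?_
  rw [Finset.sum_comm]
  refine Finset.sum_congr rfl fun a' _ => ?_
  rw [← Finset.mul_sum, sum_isometry_mul_star_right]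

theorem traceFst_isometry_conj (m : Mult) (ρ : Op (Cfg D m.QA)) :
    traceFst (m.isometry D * ρ * (m.isometry D)ᴴ) = m.prodChannelC D ρ := by
  ext c c'
  simp only [traceFst, Mult.prodChannelC, Matrix.of_apply, mul_mul_conjTranspose_apply]
  rw [Finset.sum_comm]
  refine Finset.sum_congr rfl fun a _ => ?_
  rw [Finset.sum_comm]
  refine Finset.sum_congr rfl fun a' _ => ?_
  rw [← Finset.mul_sum, sum_isometry_mul_star_left]

end Channels

/-- Two isometries with the same range differ by a unitary. -/
theorem exists_unitary_of_range_eq {κ α α' : Type} [Fintype κ] [DecidableEq κ] [Fintype α]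
    [DecidableEq α] [Fintype α'] [DecidableEq α'] {V : Matrix κ α ℂ} {G : Matrix κ α' ℂ}
    (hV : Vᴴ * V = 1) (hG : Gᴴ * G = 1) (h : Set.range V.mulVec = Set.range G.mulVec) :
    ∃ Y : Matrix α α' ℂ, Yᴴ * Y = 1 ∧ Y * Yᴴ = 1 ∧ V * Y = G := by
  have factor : ∀ {α α' : Type} [Fintype α] [DecidableEq α] [Fintype α'] [DecidableEq α']
      {V : Matrix κ α ℂ} {G : Matrix κ α' ℂ}, Set.range G.mulVec ⊆ Set.range V.mulVec →
      ∃ Y : Matrix α α' ℂ, V * Y = G := by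
    intro α α' _ _ _ _ V G h
    have h1 : ∀ a, ∃ y, V *ᵥ y = G.col a := fun a =>
      h ⟨Pi.single a 1, Matrix.mulVec_single_one G a⟩
    choose y hy using h1
    refine ⟨(Matrix.of y)ᵀ, ?_⟩
    ext i a
    exact congrFun (hy a) i
  -- Each isometry factors through the other; since `Y = Vᴴ * G`, these factorizations make `Y`
  -- unitary.
  obtain ⟨Y, hY⟩ := factor h.ge
  obtain ⟨N, hN⟩ := factor h.le
  have hY' : Y = Vᴴ * G := by rw [← hY, ← Matrix.mul_assoc, hV, Matrix.one_mul]
  refine ⟨Y, ?_, ?_, hY⟩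
  · have : Gᴴ * V * Y = 1 := by rw [Matrix.mul_assoc, hY, hG]
    rwa [hY', Matrix.conjTranspose_mul, Matrix.conjTranspose_conjTranspose, ← hY']
  · rw [hY', Matrix.conjTranspose_mul, Matrix.conjTranspose_conjTranspose]
    have : G * (Gᴴ * V) = V := by rw [← hN, ← Matrix.mul_assoc Gᴴ, hG, Matrix.one_mul]
    rw [Matrix.mul_assoc, this, hV]

/-! ### From the code isometry to the local unitaries -/

section Assembly

variable {D : ℕ} [Fact D.Prime] {n k : ℕ}

theorem splitOutput_conjTranspose_mul_self (B : Finset (Fin n))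
    {V : Matrix (Cfg D (Fin n)) (Cfg D (Fin k)) ℂ} (hV : Vᴴ * V = 1) :
    (splitOutput B V)ᴴ * splitOutput B V = 1 := by
  rw [splitOutput, Matrix.conjTranspose_submatrix, Matrix.submatrix_mul_equiv, hV]
  exact Matrix.submatrix_one_equiv (Equiv.refl _)

/-- The image of a stabilizer code isometry is determined by its stabilizer. -/
theorem mem_range_splitOutput (B : Finset (Fin n))
    {V : Matrix (Cfg D (Fin n)) (Cfg D (Fin k)) ℂ} (hV : IsStabilizerCodeIsometry V)
    (ψ : Cfg D (PartB B) × Cfg D (PartC B) → ℂ)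
    (h : ∀ (c : ℂ) l, (∀ φ ∈ Set.range (splitOutput B V).mulVec, (c • weyl₂ l) *ᵥ φ = φ) →
      (c • weyl₂ l) *ᵥ ψ = ψ) : ψ ∈ Set.range (splitOutput B V).mulVec := by
  obtain ⟨-, S, hS, hcode, -⟩ := hV
  set e := Equiv.piEquivPiSubtypeProd (fun q => q ∈ B) (fun _ => ZMod D) with he
  have hsub : ∀ (M : Op (Cfg D (Fin n))) (φ : Cfg D (Fin n) → ℂ),
      M.submatrix e.symm e.symm *ᵥ (φ ∘ e.symm) = (M *ᵥ φ) ∘ e.symm := by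
    intro M φ
    rw [Matrix.submatrix_mulVec_equiv]
    congr 2
    ext i
    simp
  have hVx : ∀ x, splitOutput B V *ᵥ x = (V *ᵥ x) ∘ e.symm := fun x => rfl
  -- Each element of the group is, after splitting, a multiple of some `weyl₂ l` fixing the image of
  -- `V`; by hypothesis it fixes `ψ` too.
  have hmem : ψ ∘ e ∈ codeSpace S := by
    intro s hs
    obtain ⟨γ, x, z, hγ⟩ := hS.isPauli s hs
    set l : Phase D (PartB B) × Phase D (PartC B) :=
      (phaseRestrict (fun q => q ∈ B) (x, z), phaseRestrict (fun q => q ∉ B) (x, z)) with hl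
    have hs' : (s : Op (Cfg D (Fin n))).submatrix e.symm e.symm = lam D ^ γ.val • weyl₂ l := by
      rw [hγ, pauliProduct_eq, weyl₂, ← weyl_submatrix]
      rfl
    have h1 := h (lam D ^ γ.val) l (by
      rintro _ ⟨y, rfl⟩
      have hy : V *ᵥ y ∈ codeSpace S := by
        rw [hcode]
        exact ⟨y, rfl⟩
      rw [← hs', hVx, hsub, hy s hs])
    have h2 := hsub s (ψ ∘ e)
    rw [Function.comp_assoc, e.self_comp_symm, Function.comp_id, hs', h1] at h2
    conv_rhs => rw [h2, Function.comp_assoc, e.symm_comp_self, Function.comp_id]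
  rw [hcode] at hmem
  obtain ⟨y, hy⟩ := hmem
  refine ⟨y, ?_⟩
  have hy' : V *ᵥ y = ψ ∘ e := hy
  rw [hVx, hy', Function.comp_assoc, e.self_comp_symm, Function.comp_id]

theorem exists_frames (B : Finset (Fin n)) {V : Matrix (Cfg D (Fin n)) (Cfg D (Fin k)) ℂ}
    (hV : IsStabilizerCodeIsometry V) :
    ∃ (m : Mult) (EB : Matrix (Cfg D (PartB B)) (Cfg D m.QB) ℂ)
      (EC : Matrix (Cfg D (PartC B)) (Cfg D m.QC) ℂ) (Y : Matrix (Cfg D (Fin k)) (Cfg D m.QA) ℂ),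
      Nonempty (Fin k ≃ m.QA) ∧ Nonempty (PartB B ≃ m.QB) ∧ Nonempty (PartC B ≃ m.QC) ∧
      (Yᴴ * Y = 1 ∧ Y * Yᴴ = 1) ∧ (EBᴴ * EB = 1 ∧ EB * EBᴴ = 1) ∧ (ECᴴ * EC = 1 ∧ EC * ECᴴ = 1) ∧
      (EBᴴ ⊗ₖ ECᴴ) * splitOutput B V * Y = m.isometry D := by
  have hV' := splitOutput_conjTranspose_mul_self B hV.1
  have hne : splitOutput B V *ᵥ Pi.single 0 1 ≠ 0 := by
    intro h
    have h1 := congrArg (fun ψ => (splitOutput B V)ᴴ *ᵥ ψ) h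
    simp only [Matrix.mulVec_mulVec, hV', Matrix.one_mulVec, Matrix.mulVec_zero] at h1
    simpa using congrFun h1 0
  obtain ⟨m, hcardB, hcardC, EB, EC, hEB, hEB', hEC, hEC', hmem⟩ :=
    exists_standard_form (S := Set.range (splitOutput B V).mulVec) ⟨_, rfl⟩ hne (mem_range_splitOutput B hV)
  have hE : (EB ⊗ₖ EC)ᴴ * (EB ⊗ₖ EC) = 1 := by
    rw [Matrix.conjTranspose_kronecker, ← Matrix.mul_kronecker_mul, hEB, hEC,
      Matrix.one_kronecker_one]
  have hE' : (EB ⊗ₖ EC) * (EB ⊗ₖ EC)ᴴ = 1 := by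
    rw [Matrix.conjTranspose_kronecker, ← Matrix.mul_kronecker_mul, hEB', hEC',
      Matrix.one_kronecker_one]
  have hG : ((EB ⊗ₖ EC) * m.isometry D)ᴴ * ((EB ⊗ₖ EC) * m.isometry D) = 1 := by
    rw [Matrix.conjTranspose_mul, Matrix.mul_assoc, ← Matrix.mul_assoc _ (EB ⊗ₖ EC), hE,
      Matrix.one_mul, isometry_conjTranspose_mul_self]
  have hrange : Set.range (splitOutput B V).mulVec =
      Set.range ((EB ⊗ₖ EC) * m.isometry D).mulVec := by
    ext ψ
    have hψ : (EB ⊗ₖ EC) *ᵥ ((EB ⊗ₖ EC)ᴴ *ᵥ ψ) = ψ := by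
      rw [Matrix.mulVec_mulVec, hE', Matrix.one_mulVec]
    constructor
    · intro h
      rw [← hψ, hmem] at h
      obtain ⟨x, hx⟩ := h.exists_isometry_mulVec
      exact ⟨x, by rw [← Matrix.mulVec_mulVec, hx, hψ]⟩
    · rintro ⟨x, rfl⟩
      rw [← Matrix.mulVec_mulVec]
      exact (hmem _).mpr (isStandardKet_isometry_mulVec m x)
  obtain ⟨Y, hY, hY', hVY⟩ := exists_unitary_of_range_eq hV' hG hrange
  -- The count of input qudits comes from `Y` being square: `D ^ k` equals `D` to the number of
  -- elementary inputs.
  have hcardA : Fintype.card (Fin k) = Fintype.card m.QA := by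
    have h1 := Matrix.square_of_invertible Y Yᴴ hY' hY
    rw [Fintype.card_pi, Fintype.card_pi] at h1
    simp only [ZMod.card, Finset.prod_const, Finset.card_univ] at h1
    exact Nat.pow_right_injective (Fact.out : D.Prime).two_le h1
  refine ⟨m, EB, EC, Y, ⟨Fintype.equivOfCardEq hcardA⟩, ⟨Fintype.equivOfCardEq hcardB⟩,
    ⟨Fintype.equivOfCardEq hcardC⟩, ⟨hY, hY'⟩, ⟨hEB, hEB'⟩, ⟨hEC, hEC'⟩, ?_⟩
  rw [Matrix.mul_assoc, hVY, ← Matrix.conjTranspose_kronecker, ← Matrix.mul_assoc, hE,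
    Matrix.one_mul]

/-- Relabelling of qudits. -/
def relabel (D : ℕ) {P Q : Type} (e : P ≃ Q) : Cfg D P ≃ Cfg D Q := e.arrowCongr (Equiv.refl _)

theorem submatrix_mem_unitaryGroup {P Q : Type} [Fintype P] [DecidableEq P] [Fintype Q]
    [DecidableEq Q] {Y : Matrix P Q ℂ} (f : P ≃ Q) (h : Y * Yᴴ = 1) :
    Y.submatrix id f ∈ Matrix.unitaryGroup P ℂ := by
  rw [Matrix.mem_unitaryGroup_iff, Matrix.star_eq_conjTranspose, Matrix.conjTranspose_submatrix,
    Matrix.submatrix_mul_equiv, h, Matrix.submatrix_id_id]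

theorem conjTranspose_submatrix_mem_unitaryGroup {P Q : Type} [Fintype P] [DecidableEq P]
    [Fintype Q] [DecidableEq Q] {E : Matrix Q P ℂ} (f : Q ≃ P) (h : Eᴴ * E = 1) :
    Eᴴ.submatrix f id ∈ Matrix.unitaryGroup Q ℂ := by
  have h1 : (Eᴴ.submatrix f id) * (E.submatrix id f) = 1 := by
    have := Matrix.submatrix_mul_equiv Eᴴ E f (Equiv.refl Q) f
    rw [Equiv.coe_refl] at this
    rw [this, h, Matrix.submatrix_one_equiv]
  rw [Matrix.mem_unitaryGroup_iff, Matrix.star_eq_conjTranspose, Matrix.conjTranspose_submatrix,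
    Matrix.conjTranspose_conjTranspose, h1]

theorem kronecker_submatrix_mul {β γ β' γ' α α' : Type} [Fintype β] [Fintype γ] [Fintype α]
    {E : Matrix β' β ℂ} {E' : Matrix γ' γ ℂ} {V : Matrix (β × γ) α ℂ} {Y : Matrix α α' ℂ}
    {G : Matrix (β' × γ') α' ℂ} (h : (E ⊗ₖ E') * V * Y = G) {β'' γ'' α'' : Type} (f : β'' → β')
    (g : γ'' → γ') (e : α'' → α') :
    (E.submatrix f id ⊗ₖ E'.submatrix g id) * V * Y.submatrix id e =
      G.submatrix (fun x => (f x.1, g x.2)) e := by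
  rw [← h]
  rfl

theorem kronecker_conj_conj {β γ β' γ' α : Type} [Fintype β] [Fintype γ] [Fintype α]
    (U : Matrix β' β ℂ) (U' : Matrix γ' γ ℂ) (V : Matrix (β × γ) α ℂ) (A ρ : Op α) :
    (U ⊗ₖ U') * (V * (A * ρ * Aᴴ) * Vᴴ) * (U ⊗ₖ U')ᴴ =
      ((U ⊗ₖ U') * V * A) * ρ * ((U ⊗ₖ U') * V * A)ᴴ := by
  simp only [Matrix.conjTranspose_mul, Matrix.mul_assoc]

theorem isometry_submatrix_conj (m : Mult) {P Q R : Type} [Fintype P] [DecidableEq P] (eA : P ≃ m.QA)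
    (eB : Q ≃ m.QB) (eC : R ≃ m.QC) (ρ : Op (Cfg D P)) :
    (m.isometry D).submatrix (fun x : Cfg D Q × Cfg D R => (relabel D eB x.1, relabel D eC x.2))
        (relabel D eA) * ρ * ((m.isometry D).submatrix
          (fun x : Cfg D Q × Cfg D R => (relabel D eB x.1, relabel D eC x.2)) (relabel D eA))ᴴ =
      (m.isometry D * ρ.submatrix (relabel D eA).symm (relabel D eA).symm *
        (m.isometry D)ᴴ).submatrix (fun x => (relabel D eB x.1, relabel D eC x.2))
          fun x => (relabel D eB x.1, relabel D eC x.2) := by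
  have hρ : ρ = (ρ.submatrix (relabel D eA).symm (relabel D eA).symm).submatrix (relabel D eA)
      (relabel D eA) := by
    ext i j
    simp
  conv_lhs => rw [hρ]
  rw [Matrix.conjTranspose_submatrix, Matrix.submatrix_mul_equiv, Matrix.submatrix_mul_equiv]

theorem channelB_conj (B : Finset (Fin n)) (V : Matrix (Cfg D (Fin n)) (Cfg D (Fin k)) ℂ)
    {m : Mult} (eA : Fin k ≃ m.QA) (eB : PartB B ≃ m.QB) (eC : PartC B ≃ m.QC)
    {UA : Op (Cfg D (Fin k))} {UB : Op (Cfg D (PartB B))} {UC : Op (Cfg D (PartC B))}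
    (hUC : UC ∈ Matrix.unitaryGroup (Cfg D (PartC B)) ℂ)
    (h : (UB ⊗ₖ UC) * splitOutput B V * UA = (m.isometry D).submatrix
      (fun x => (relabel D eB x.1, relabel D eC x.2)) (relabel D eA)) (ρ : Op (Cfg D (Fin k))) :
    UB * channelB B V (UA * ρ * UAᴴ) * UBᴴ =
      (m.prodChannelB D (ρ.submatrix (relabel D eA).symm (relabel D eA).symm)).submatrix
        (relabel D eB) (relabel D eB) := by
  rw [channelB, ← traceSnd_kronecker_conj UB (Matrix.mem_unitaryGroup_iff'.mp hUC),
    kronecker_conj_conj, h, isometry_submatrix_conj, traceSnd_submatrix, traceSnd_isometry_conj]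

theorem channelC_conj (B : Finset (Fin n)) (V : Matrix (Cfg D (Fin n)) (Cfg D (Fin k)) ℂ)
    {m : Mult} (eA : Fin k ≃ m.QA) (eB : PartB B ≃ m.QB) (eC : PartC B ≃ m.QC)
    {UA : Op (Cfg D (Fin k))} {UB : Op (Cfg D (PartB B))} {UC : Op (Cfg D (PartC B))}
    (hUB : UB ∈ Matrix.unitaryGroup (Cfg D (PartB B)) ℂ)
    (h : (UB ⊗ₖ UC) * splitOutput B V * UA = (m.isometry D).submatrix
      (fun x => (relabel D eB x.1, relabel D eC x.2)) (relabel D eA)) (ρ : Op (Cfg D (Fin k))) :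
    UC * channelC B V (UA * ρ * UAᴴ) * UCᴴ =
      (m.prodChannelC D (ρ.submatrix (relabel D eA).symm (relabel D eA).symm)).submatrix
        (relabel D eC) (relabel D eC) := by
  rw [channelC, ← traceFst_kronecker_conj UC (Matrix.mem_unitaryGroup_iff'.mp hUB),
    kronecker_conj_conj, h, isometry_submatrix_conj, traceFst_submatrix, traceFst_isometry_conj]

end Assembly

end StabCode

end

theorem theorem9 (D : ℕ) [Fact D.Prime] (n k : ℕ) (B : Finset (Fin n))
    (V : Matrix (StabCode.Cfg D (Fin n)) (StabCode.Cfg D (Fin k)) ℂ)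
    (hV : StabCode.IsStabilizerCodeIsometry V) :
    ∃ (m : StabCode.Mult)
      (eA : Fin k ≃ m.QA) (eB : StabCode.PartB B ≃ m.QB) (eC : StabCode.PartC B ≃ m.QC)
      (UA : StabCode.Op (StabCode.Cfg D (Fin k)))
      (UB : StabCode.Op (StabCode.Cfg D (StabCode.PartB B)))
      (UC : StabCode.Op (StabCode.Cfg D (StabCode.PartC B))),
      UA ∈ Matrix.unitaryGroup (StabCode.Cfg D (Fin k)) ℂ ∧
      UB ∈ Matrix.unitaryGroup (StabCode.Cfg D (StabCode.PartB B)) ℂ ∧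
      UC ∈ Matrix.unitaryGroup (StabCode.Cfg D (StabCode.PartC B)) ℂ ∧
      (UB ⊗ₖ UC) * StabCode.splitOutput B V * UA =
        (m.isometry D).submatrix (fun x => (x.1 ∘ eB.symm, x.2 ∘ eC.symm))
          (fun a => a ∘ eA.symm) ∧
      (∀ ρ : StabCode.Op (StabCode.Cfg D (Fin k)),
        UB * StabCode.channelB B V (UA * ρ * UAᴴ) * UBᴴ =
          (m.prodChannelB D (ρ.submatrix (fun a => a ∘ eA) (fun a => a ∘ eA))).submatrix
            (fun b => b ∘ eB.symm) (fun b => b ∘ eB.symm)) ∧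
      (∀ ρ : StabCode.Op (StabCode.Cfg D (Fin k)),
        UC * StabCode.channelC B V (UA * ρ * UAᴴ) * UCᴴ =
          (m.prodChannelC D (ρ.submatrix (fun a => a ∘ eA) (fun a => a ∘ eA))).submatrix
            (fun c => c ∘ eC.symm) (fun c => c ∘ eC.symm)) := by
  obtain ⟨m, EB, EC, Y, ⟨eA⟩, ⟨eB⟩, ⟨eC⟩, ⟨-, hY'⟩, ⟨hEB, -⟩, ⟨hEC, -⟩, hiso⟩ :=
    StabCode.exists_frames B hV
  have hUB := StabCode.conjTranspose_submatrix_mem_unitaryGroup (StabCode.relabel D eB) hEB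
  have hUC := StabCode.conjTranspose_submatrix_mem_unitaryGroup (StabCode.relabel D eC) hEC
  have hW := StabCode.kronecker_submatrix_mul hiso (StabCode.relabel D eB) (StabCode.relabel D eC)
    (StabCode.relabel D eA)
  -- The unitaries are `Y`, `EBᴴ` and `ECᴴ` with the standard side relabelled; `relabel D e` unfolds
  -- to composition with `e.symm`.
  exact ⟨m, eA, eB, eC, _, _, _, StabCode.submatrix_mem_unitaryGroup (StabCode.relabel D eA) hY',
    hUB, hUC, hW, StabCode.channelB_conj B V eA eB eC hUC hW,
    StabCode.channelC_conj B V eA eB eC hUB hW⟩
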